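/- Call a positive semidefinite matrix of trace one in $M_3(\mathbb{C})\otimes M_3(\mathbb{C})$ a state, and let $\mathcal{AP}_{3,3}$ be the set of absolutely PPT states, i.e. the states $\rho$ such that $(\mathrm{id}\otimes T)(U\rho U^\dagger)$ is positive semidefinite for every unitary $U\in M_9(\mathbb{C})$, where $T$ denotes transposition on the second factor. A point $\rho\in\mathcal{AP}_{3,3}$ is called an interior point if there is $\epsilon\in(0,1)$ with $\frac{1}{1-\epsilon}\left(\rho-\frac{\epsilon}{9}I_9\right)\in\mathcal{AP}_{3,3}$, and a boundary point otherwise; it is called an extreme point if $\rho=t\rho_1+(1-t)\rho_2$ with $t\in(0,1)$ and $\rho_1,\rho_2\in\mathcal{AP}_{3,3}$ implies $\rho_1=\rho_2$. **Theorem 4.3.** Let $\rho=\mathrm{diag}(\lambda_1,\dots,\lambda_9)$ with $\lambda_1\ge\cdots\ge\lambda_9$ be a boundary point of $\mathcal{AP}_{3,3}$. Then $\rho$ is not an extreme point of $\mathcal{AP}_{3,3}$ if and only if $\rho=\frac12(\alpha+\beta)$ for some two linearly independent diagonal states $\alpha,\beta\in\mathcal{AP}_{3,3}$ whose diagonal entries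 are both in non-increasing order. -/

import Mathlib

open scoped ComplexOrder

/-- The quantum states of the `m × n` system `M_m(ℂ) ⊗ M_n(ℂ)`: positive semidefinite matrices of
trace one. The composite index `(i, k)` stands for the basis vector `e_i ⊗ e_k`. -/
def IsQState {m n : ℕ} (ρ : Matrix (Fin m × Fin n) (Fin m × Fin n) ℂ) : Prop :=
  ρ.PosSemidef ∧ ρ.trace = 1

/-- The partial transpose `id_m ⊗ T`: it sends `A ⊗ B` to `A ⊗ Bᵀ`. -/
def partialTranspose {m n : ℕ} (ρ : Matrix (Fin m × Fin n) (Fin m × Fin n) ℂ) :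
    Matrix (Fin m × Fin n) (Fin m × Fin n) ℂ :=
  Matrix.of fun p q => ρ (p.1, q.2) (q.1, p.2)

/-- The set of absolutely PPT states of the `m × n` system: the states `ρ` such that `U ρ U†` has
positive semidefinite partial transpose for every (global) unitary `U`. -/
def AbsPPT (m n : ℕ) : Set (Matrix (Fin m × Fin n) (Fin m × Fin n) ℂ) :=
  {ρ | IsQState ρ ∧ ∀ U ∈ Matrix.unitaryGroup (Fin m × Fin n) ℂ,
    (partialTranspose (U * ρ * U.conjTranspose)).PosSemidef}

/-- `ρ` is an interior point of `AbsPPT m n`: it belongs to the set, and so does the matrix obtained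
from it by removing a proportion `ε ∈ (0,1)` of the maximally mixed state and renormalizing. -/
def IsAbsPPTInterior {m n : ℕ} (ρ : Matrix (Fin m × Fin n) (Fin m × Fin n) ℂ) : Prop :=
  ρ ∈ AbsPPT m n ∧ ∃ ε : ℝ, 0 < ε ∧ ε < 1 ∧
    (1 / (1 - ε)) • (ρ - ε • ((1 / ((m : ℝ) * (n : ℝ))) •
      (1 : Matrix (Fin m × Fin n) (Fin m × Fin n) ℂ))) ∈ AbsPPT m n

/-- A boundary point of `AbsPPT m n` is a point of the set that is not an interior point. -/
def IsAbsPPTBoundary {m n : ℕ} (ρ : Matrix (Fin m × Fin n) (Fin m × Fin n) ℂ) : Prop :=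
  ρ ∈ AbsPPT m n ∧ ¬ IsAbsPPTInterior ρ

/-- The diagonal matrix `diag(a_1, …, a_{mn})` with real entries, acting on `ℂ^m ⊗ ℂ^n` whose
product basis is listed lexicographically: `finProdFinEquiv (i, k) = k + n * i`. -/
noncomputable def diagMat {m n : ℕ} (a : Fin (m * n) → ℝ) :
    Matrix (Fin m × Fin n) (Fin m × Fin n) ℂ :=
  Matrix.diagonal fun p => ((a (finProdFinEquiv p) : ℝ) : ℂ)

/-! Membership in the set depends only on the spectrum. Local unitaries bring a test vector to its
Schmidt form, so positivity of all the partial transposes says that the spectrum pairs nonnegatively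
with the eigenvalues of `schmidtSwap s` under every unitary overlap. By Birkhoff's theorem and
rearrangement, the worst case pairs the two lists in opposite orders. For Schmidt coefficients `s 0
≥ s 1 ≥ s 2 ≥ 0` only the order of `s 1 ^ 2` and `s 0 * s 2` is undetermined, which leaves two
ternary quadratic forms, linear in the ordered spectrum. At a boundary point compactness gives a
unit vector `s` where the relevant form vanishes.

Let the boundary point `diagMat l` be `t • ρ₁ + u • ρ₂`, with ordered spectra `a`, `b`, and put `n =
t a + u b`. By Schur's theorem `n` majorizes `l`, and `diagMat n` is again in the set. At the zero
`s` the pairing with `n` is squeezed between zero and the pairing with `l`, so it vanishes. Abel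
summation kills the partial sums of `n - l` wherever consecutive weights differ; the vanishing
gradients of the forms, with the order and majorization inequalities, settle the ties. Hence `n =
l`.

If `a ≠ b`, then `l` is interior to a segment of ordered spectra and so is a midpoint. If `a = b =
l`, all three matrices have the same Frobenius norm, and strict convexity forces `ρ₁ = ρ₂`. -/

/-! ### Doubly stochastic matrices and rearrangement -/

/-- The squared moduli of the entries of a unitary matrix form a doubly stochastic matrix. -/
theorem normSq_mem_doublyStochastic {n : Type*} [Fintype n] [DecidableEq n] {U : Matrix n n ℂ}
    (hU : U ∈ Matrix.unitaryGroup n ℂ) :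
    (Matrix.of fun i j => Complex.normSq (U i j)) ∈ doublyStochastic ℝ n := by
  rw [mem_doublyStochastic_iff_sum]
  refine ⟨fun i j => Complex.normSq_nonneg _, fun i => ?_, fun j => ?_⟩
  · have h := congrFun (congrFun (Matrix.mem_unitaryGroup_iff.1 hU) i) i
    rw [Matrix.mul_apply, Matrix.one_apply_eq] at h
    apply Complex.ofReal_injective
    rw [Complex.ofReal_sum, Complex.ofReal_one, ← h]
    exact Finset.sum_congr rfl fun j _ => (Complex.mul_conj _).symm
  · have h := congrFun (congrFun (Matrix.mem_unitaryGroup_iff'.1 hU) j) j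
    rw [Matrix.mul_apply, Matrix.one_apply_eq] at h
    apply Complex.ofReal_injective
    rw [Complex.ofReal_sum, Complex.ofReal_one, ← h]
    exact Finset.sum_congr rfl fun i _ => Complex.normSq_eq_conj_mul_self

/-- Rearrangement inequality for doubly stochastic matrices. -/
theorem Antivary.sum_mul_le_sum_doublyStochastic {n : Type*} [Fintype n] [DecidableEq n]
    {f g : n → ℝ} (hfg : Antivary f g) {M : Matrix n n ℝ} (hM : M ∈ doublyStochastic ℝ n) :
    ∑ i, f i * g i ≤ ∑ i, ∑ j, M i j * (f i * g j) := by
  -- Birkhoff's theorem: `M` is a convex combination of permutation matrices, and the classical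
  -- rearrangement inequality applies to each.
  obtain ⟨w, hw, hw1, rfl⟩ := exists_eq_sum_perm_of_mem_doublyStochastic hM
  have key : ∑ i, ∑ j, (∑ σ, w σ • σ.permMatrix ℝ) i j * (f i * g j)
      = ∑ σ, w σ * ∑ i, f i * g (σ i) := by
    simp_rw [Matrix.sum_apply, Finset.sum_mul, Finset.mul_sum]
    rw [Finset.sum_comm' (t' := Finset.univ) (s' := fun _ => Finset.univ) (by simp)]
    rw [Finset.sum_comm]
    simp_rw [Finset.sum_comm (s := (Finset.univ : Finset n)) (t := (Finset.univ : Finset (Equiv.Perm n)))]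
    refine Finset.sum_congr rfl fun σ _ => ?_
    refine Finset.sum_congr rfl fun i _ => ?_
    rw [Finset.sum_eq_single (σ i)]
    · simp [PEquiv.toMatrix_apply, Equiv.toPEquiv_apply]
    · intro j _ hj
      simp [PEquiv.toMatrix_apply, Equiv.toPEquiv_apply, hj.symm]
    · simp
  rw [key, ← one_mul (∑ i, f i * g i), ← hw1, Finset.sum_mul]
  exact Finset.sum_le_sum fun σ _ =>
    mul_le_mul_of_nonneg_left hfg.sum_mul_le_sum_mul_comp_perm (hw σ)

theorem exists_perm_antitone_comp {N : ℕ} (f : Fin N → ℝ) :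
    ∃ σ : Equiv.Perm (Fin N), Antitone (f ∘ σ) := by
  refine ⟨Tuple.sort (fun i => - f i), fun i j hij => ?_⟩
  have h := Tuple.monotone_sort (fun i => - f i) hij
  simpa using h

theorem submatrix_col_mem_unitaryGroup {n : Type*} [Fintype n] [DecidableEq n] {U : Matrix n n ℂ}
    (hU : U ∈ Matrix.unitaryGroup n ℂ) (σ : Equiv.Perm n) :
    U.submatrix id σ ∈ Matrix.unitaryGroup n ℂ := by
  rw [Matrix.mem_unitaryGroup_iff] at hU ⊢
  rw [Matrix.star_eq_conjTranspose, Matrix.conjTranspose_submatrix, Matrix.submatrix_mul_equiv]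
  simpa [Matrix.star_eq_conjTranspose] using hU

theorem conjTranspose_mem_unitaryGroup {n : Type*} [Fintype n] [DecidableEq n] {U : Matrix n n ℂ}
    (hU : U ∈ Matrix.unitaryGroup n ℂ) : U.conjTranspose ∈ Matrix.unitaryGroup n ℂ :=
  Unitary.star_mem hU

/-! ### Ordered spectral and singular value decompositions -/

/-- Spectral theorem with the eigenvalues listed in non-increasing order along an enumeration of
the index type. -/
theorem Matrix.IsHermitian.exists_eq_antitone_diagonal {n : Type*} [Fintype n] [DecidableEq n]
    {N : ℕ} (e : n ≃ Fin N) {A : Matrix n n ℂ} (hA : A.IsHermitian) :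
    ∃ U ∈ Matrix.unitaryGroup n ℂ, ∃ μ : Fin N → ℝ, Antitone μ ∧
      A = U * Matrix.diagonal (fun p => ((μ (e p) : ℝ) : ℂ)) * U.conjTranspose := by
  obtain ⟨τ, hτ⟩ := exists_perm_antitone_comp (hA.eigenvalues ∘ e.symm)
  let σ : Equiv.Perm n := (e.trans τ).trans e.symm
  refine ⟨_, submatrix_col_mem_unitaryGroup hA.eigenvectorUnitary.2 σ, _, hτ, ?_⟩
  have hd : Matrix.diagonal (fun p => ((((hA.eigenvalues ∘ e.symm) ∘ τ) (e p) : ℝ) : ℂ))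
      = (Matrix.diagonal (RCLike.ofReal ∘ hA.eigenvalues) : Matrix n n ℂ).submatrix σ σ := by
    rw [Matrix.submatrix_diagonal_equiv]
    rfl
  rw [hd, Matrix.conjTranspose_submatrix, Matrix.submatrix_mul_equiv, Matrix.submatrix_mul_equiv,
    Matrix.submatrix_id_id]
  conv_lhs => rw [hA.spectral_theorem]
  rw [Unitary.conjStarAlgAut_apply]
  rfl

/-- Singular value decomposition of a square complex matrix, singular values non-increasing. -/
theorem Matrix.exists_singular_value_decomposition {N : ℕ} (X : Matrix (Fin N) (Fin N) ℂ) :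
    ∃ V ∈ Matrix.unitaryGroup (Fin N) ℂ, ∃ W ∈ Matrix.unitaryGroup (Fin N) ℂ,
      ∃ s : Fin N → ℝ, Antitone s ∧ (∀ i, 0 ≤ s i) ∧
        X = V * Matrix.diagonal (fun i => ((s i : ℝ) : ℂ)) * W := by
  have hps : (X.conjTranspose * X).PosSemidef := Matrix.posSemidef_conjTranspose_mul_self X
  obtain ⟨E, hE, μ, hμ, hX⟩ := hps.isHermitian.exists_eq_antitone_diagonal (Equiv.refl _)
  have hEE : E.conjTranspose * E = 1 := Matrix.mem_unitaryGroup_iff'.1 hE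
  have hEE' : E * E.conjTranspose = 1 := Matrix.mem_unitaryGroup_iff.1 hE
  -- The columns of `X * E` are orthogonal with squared norms `μ`; normalizing them will give the
  -- left singular vectors.
  set Y : Matrix (Fin N) (Fin N) ℂ := X * E with hY
  have hYY : Y.conjTranspose * Y = Matrix.diagonal (fun p => ((μ p : ℝ) : ℂ)) := by
    rw [hY, Matrix.conjTranspose_mul, Matrix.mul_assoc, ← Matrix.mul_assoc _ X, hX,
      Matrix.mul_assoc, Matrix.mul_assoc, hEE, Matrix.mul_one, ← Matrix.mul_assoc, hEE,
      Matrix.one_mul]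
    rfl
  let y : Fin N → EuclideanSpace ℂ (Fin N) := fun j => WithLp.toLp 2 (fun i => Y i j)
  have hin : ∀ i j, inner ℂ (y i) (y j) = if i = j then ((μ i : ℝ) : ℂ) else 0 := by
    intro i j
    have h := congrFun (congrFun hYY i) j
    rw [Matrix.diagonal_apply] at h
    rw [← h, Matrix.mul_apply, PiLp.inner_apply]
    exact Finset.sum_congr rfl fun k _ => by simp [y, mul_comm]
  have hnorm : ∀ i, ‖y i‖ ^ 2 = μ i := by
    intro i
    have h := hin i i
    rw [inner_self_eq_norm_sq_to_K, if_pos rfl] at h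
    exact Complex.ofReal_injective (by simpa using h)
  have hμ0 : ∀ i, 0 ≤ μ i := fun i => by rw [← hnorm]; positivity
  let v : Fin N → EuclideanSpace ℂ (Fin N) := fun j => (((√(μ j))⁻¹ : ℝ) : ℂ) • y j
  -- Only the nonzero columns can be normalized. The orthonormal extension fills the other places,
  -- where the singular value is zero and any choice works.
  have hv : Orthonormal ℂ (Set.domRestrict {j | μ j ≠ 0} v) := by
    rw [orthonormal_iff_ite]
    rintro ⟨i, hi⟩ ⟨j, hj⟩
    simp only [Set.domRestrict_apply, v, inner_smul_left, inner_smul_right, hin, Subtype.mk.injEq,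
      Complex.conj_ofReal]
    split_ifs with hij
    · subst hij
      have h0 : √(μ i) ≠ 0 := by
        rw [Real.sqrt_ne_zero (hμ0 i)]; exact hi
      have : (√(μ i))⁻¹ * ((√(μ i))⁻¹ * μ i) = 1 := by
        nth_rewrite 3 [← Real.mul_self_sqrt (hμ0 i)]
        field_simp
      exact_mod_cast this
    · simp
  obtain ⟨b, hb⟩ := hv.exists_orthonormalBasis_extension_of_card_eq (by simp)
  refine ⟨_, (EuclideanSpace.basisFun (Fin N) ℂ).toMatrix_orthonormalBasis_mem_unitary b,
    _, conjTranspose_mem_unitaryGroup hE, fun i => √(μ i),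
    fun i j h => Real.sqrt_le_sqrt (hμ h), fun i => Real.sqrt_nonneg _, ?_⟩
  have hfin : Y = (EuclideanSpace.basisFun (Fin N) ℂ).toBasis.toMatrix b *
      Matrix.diagonal (fun i => ((√(μ i) : ℝ) : ℂ)) := by
    ext i j
    rw [Matrix.mul_diagonal]
    change y j i = b j i * _
    by_cases hj : μ j = 0
    · have : y j = 0 := by
        rw [← norm_eq_zero]
        have := hnorm j
        rw [hj] at this
        exact pow_eq_zero_iff (two_ne_zero) |>.1 this
      rw [this, hj]
      simp
    · rw [hb j hj]
      have h0 : ((√(μ j) : ℝ) : ℂ) ≠ 0 := by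
        rw [Complex.ofReal_ne_zero, Real.sqrt_ne_zero (hμ0 j)]; exact hj
      simp only [v, PiLp.smul_apply, smul_eq_mul, Complex.ofReal_inv]
      field_simp
  have hfin' := congrArg (· * E.conjTranspose) hfin
  simpa only [hY, Matrix.mul_assoc, hEE', Matrix.mul_one] using hfin'

/-! ### Partial transposition and Schmidt form -/

-- Transposition reverses products, so the second-factor matrices exchange sides. This moves a local
-- unitary from the test vector onto the global unitary.
open scoped Kronecker in
theorem partialTranspose_kronecker_mul_mul {m n : ℕ} (A C : Matrix (Fin m) (Fin m) ℂ)
    (B D : Matrix (Fin n) (Fin n) ℂ) (R : Matrix (Fin m × Fin n) (Fin m × Fin n) ℂ) :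
    partialTranspose ((A ⊗ₖ B) * R * (C ⊗ₖ D)) =
      (A ⊗ₖ D.transpose) * partialTranspose R * (C ⊗ₖ B.transpose) := by
  ext ⟨i, k⟩ ⟨j, l⟩
  simp only [partialTranspose, Matrix.of_apply, Matrix.mul_apply, Matrix.kroneckerMap_apply,
    Fintype.sum_prod_type, Finset.sum_mul, Matrix.transpose_apply]
  refine Finset.sum_congr rfl fun c _ => ?_
  rw [Finset.sum_comm]
  conv_rhs => rw [Finset.sum_comm]
  refine Finset.sum_congr rfl fun a _ => ?_
  rw [Finset.sum_comm]
  refine Finset.sum_congr rfl fun b _ => Finset.sum_congr rfl fun d _ => ?_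
  ring

theorem partialTranspose_isHermitian {m n : ℕ}
    {R : Matrix (Fin m × Fin n) (Fin m × Fin n) ℂ} (hR : R.IsHermitian) :
    (partialTranspose R).IsHermitian := by
  ext p q
  exact hR.apply (p.1, q.2) (q.1, p.2)

/-- The vector `∑ i, s i • (e_i ⊗ e_i)`. -/
def schmidtVector (s : Fin 3 → ℝ) (p : Fin 3 × Fin 3) : ℂ :=
  if p.1 = p.2 then ((s p.1 : ℝ) : ℂ) else 0

/-- The partial transpose of the rank one matrix of `schmidtVector s`. -/
def schmidtSwap (s : Fin 3 → ℝ) : Matrix (Fin 3 × Fin 3) (Fin 3 × Fin 3) ℂ :=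
  Matrix.of fun p q => if p = q.swap then ((s p.1 * s p.2 : ℝ) : ℂ) else 0

/-- The eigenvalues of `schmidtSwap s`. -/
def schmidtWeight (s : Fin 3 → ℝ) (p : Fin 3 × Fin 3) : ℝ :=
  if p.1 ≤ p.2 then s p.1 * s p.2 else -(s p.1 * s p.2)

/-- A unitary matrix whose columns are eigenvectors of `schmidtSwap s`, for every `s`. -/
noncomputable def schmidtEigenbasis : Matrix (Fin 3 × Fin 3) (Fin 3 × Fin 3) ℂ :=
  Matrix.of fun p q =>
    if p = q then if q.1 = q.2 then 1 else (((√2)⁻¹ : ℝ) : ℂ)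
    else if p = q.swap then if q.1 < q.2 then (((√2)⁻¹ : ℝ) : ℂ) else -(((√2)⁻¹ : ℝ) : ℂ)
    else 0

/-- Partial transposition is self-adjoint for the trace pairing, so it can be moved onto the rank
one matrix of the Schmidt vector. -/
theorem schmidtVector_quadraticForm (s : Fin 3 → ℝ)
    (R : Matrix (Fin 3 × Fin 3) (Fin 3 × Fin 3) ℂ) :
    star (schmidtVector s) ⬝ᵥ (partialTranspose R).mulVec (schmidtVector s) =
      (R * schmidtSwap s).trace := by
  simp [dotProduct, Matrix.mulVec, Matrix.trace, Matrix.mul_apply, Fintype.sum_prod_type,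
    Fin.sum_univ_three, schmidtVector, schmidtSwap, partialTranspose]
  ring

theorem sqrt_two_inv_mul_self :
    (((√2)⁻¹ : ℝ) : ℂ) * (((√2)⁻¹ : ℝ) : ℂ) = 1 / 2 := by
  rw [← Complex.ofReal_mul, ← mul_inv, Real.mul_self_sqrt zero_le_two]
  norm_num

theorem schmidtEigenbasis_mem_unitaryGroup :
    schmidtEigenbasis ∈ Matrix.unitaryGroup (Fin 3 × Fin 3) ℂ := by
  rw [Matrix.mem_unitaryGroup_iff, Matrix.star_eq_conjTranspose]
  have h := sqrt_two_inv_mul_self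
  ext ⟨i, j⟩ ⟨k, l⟩
  rw [Matrix.mul_apply]
  simp only [Matrix.conjTranspose_apply, schmidtEigenbasis, Matrix.of_apply]
  have hs : starRingEnd ℂ (((√2)⁻¹ : ℝ) : ℂ) = (((√2)⁻¹ : ℝ) : ℂ) := Complex.conj_ofReal _
  generalize (((√2)⁻¹ : ℝ) : ℂ) = c at h hs
  fin_cases i <;> fin_cases j <;> fin_cases k <;> fin_cases l <;>
    simp [Fintype.sum_prod_type, Fin.sum_univ_three, hs, h] <;> norm_num

/-- The tensors `e_i ⊗ e_i` and the normalized symmetric and antisymmetric combinations of `e_i ⊗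
e_j`, `e_j ⊗ e_i` are eigenvectors whatever `s` is; the antisymmetric ones carry the negative sign.
-/
theorem schmidtSwap_eq (s : Fin 3 → ℝ) :
    schmidtSwap s = schmidtEigenbasis *
      Matrix.diagonal (fun p => ((schmidtWeight s p : ℝ) : ℂ)) *
        schmidtEigenbasis.conjTranspose := by
  have h : schmidtSwap s * schmidtEigenbasis = schmidtEigenbasis *
      Matrix.diagonal (fun p => ((schmidtWeight s p : ℝ) : ℂ)) := by
    ext ⟨i, j⟩ q
    rw [Matrix.mul_diagonal, Matrix.mul_apply, Finset.sum_eq_single (j, i)]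
    · obtain ⟨k, l⟩ := q
      simp only [schmidtSwap, schmidtEigenbasis, schmidtWeight, Matrix.of_apply, Prod.swap_prod_mk,
        if_true, Prod.mk.injEq]
      generalize (((√2)⁻¹ : ℝ) : ℂ) = c
      fin_cases i <;> fin_cases j <;> fin_cases k <;> fin_cases l <;> simp <;> ring
    · rintro ⟨a, b⟩ - hb
      have : ¬ (i, j) = (a, b).swap := by
        rintro h; apply hb; simp only [Prod.swap_prod_mk, Prod.mk.injEq] at h; simp [h.1, h.2]
      rw [schmidtSwap, Matrix.of_apply, if_neg this, zero_mul]
    · simp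
  rw [← h, Matrix.mul_assoc, ← Matrix.star_eq_conjTranspose,
    Matrix.mem_unitaryGroup_iff.1 schmidtEigenbasis_mem_unitaryGroup, Matrix.mul_one]

/-- `tr (C diag(a) C† diag(w))` in terms of the squared moduli of the entries of `C`. -/
theorem trace_mul_diagonal_mul_conjTranspose_mul_diagonal {n : Type*} [Fintype n] [DecidableEq n]
    (C : Matrix n n ℂ) (a w : n → ℝ) :
    (C * Matrix.diagonal (fun p => ((a p : ℝ) : ℂ)) * C.conjTranspose *
      Matrix.diagonal (fun p => ((w p : ℝ) : ℂ))).trace =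
      ((∑ q, ∑ p, Complex.normSq (C q p) * (w q * a p) : ℝ) : ℂ) := by
  rw [Matrix.trace, Complex.ofReal_sum]
  refine Finset.sum_congr rfl fun q _ => ?_
  rw [Matrix.diag_apply, Matrix.mul_diagonal, Matrix.mul_apply, Finset.sum_mul, Complex.ofReal_sum]
  refine Finset.sum_congr rfl fun p _ => ?_
  rw [Matrix.mul_diagonal, Matrix.conjTranspose_apply, Complex.ofReal_mul, ← Complex.mul_conj,
    Complex.ofReal_mul]
  simp only [RCLike.star_def]
  ring

theorem trace_conj_mul_schmidtSwap (U : Matrix (Fin 3 × Fin 3) (Fin 3 × Fin 3) ℂ)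
    (a : Fin 3 × Fin 3 → ℝ) (s : Fin 3 → ℝ) :
    (U * Matrix.diagonal (fun p => ((a p : ℝ) : ℂ)) * U.conjTranspose * schmidtSwap s).trace =
      ((∑ q, ∑ p, Complex.normSq ((schmidtEigenbasis.conjTranspose * U) q p) *
        (schmidtWeight s q * a p) : ℝ) : ℂ) := by
  rw [← trace_mul_diagonal_mul_conjTranspose_mul_diagonal, schmidtSwap_eq,
    Matrix.conjTranspose_mul, Matrix.conjTranspose_conjTranspose]
  simp only [← Matrix.mul_assoc]
  rw [Matrix.trace_mul_comm]
  simp only [← Matrix.mul_assoc]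

open scoped Kronecker in
/-- Every value of the quadratic form of the partial transpose of a matrix unitarily similar to a
diagonal one is a doubly stochastic pairing of the diagonal with the weights of some Schmidt
coefficients. -/
theorem exists_quadraticForm_partialTranspose_eq {U : Matrix (Fin 3 × Fin 3) (Fin 3 × Fin 3) ℂ}
    (hU : U ∈ Matrix.unitaryGroup (Fin 3 × Fin 3) ℂ) (a : Fin 3 × Fin 3 → ℝ)
    (x : Fin 3 × Fin 3 → ℂ) :
    ∃ s : Fin 3 → ℝ, Antitone s ∧ (∀ i, 0 ≤ s i) ∧
      ∃ M ∈ doublyStochastic ℝ (Fin 3 × Fin 3),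
        star x ⬝ᵥ (partialTranspose (U * Matrix.diagonal (fun p => ((a p : ℝ) : ℂ)) *
          U.conjTranspose)).mulVec x =
            ((∑ q, ∑ p, M q p * (schmidtWeight s q * a p) : ℝ) : ℂ) := by
  -- The singular value decomposition of the coefficient matrix of `x` is its Schmidt decomposition.
  obtain ⟨V, hV, W, hW, s, hs, hs0, hX⟩ :=
    Matrix.exists_singular_value_decomposition (Matrix.of fun i j => x (i, j))
  have hx : x = (V ⊗ₖ W.transpose).mulVec (schmidtVector s) := by
    ext ⟨i, k⟩
    have h := congrFun (congrFun hX i) k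
    rw [Matrix.of_apply] at h
    rw [h, Matrix.mul_apply]
    simp [Matrix.mulVec, dotProduct, Fintype.sum_prod_type, schmidtVector, Matrix.mul_diagonal]
    exact Finset.sum_congr rfl fun m _ => by ring
  -- Chosen so that the partial transpose of `K * R * K†` has `V ⊗ Wᵀ`, the local unitary producing
  -- `x`, as its right factor.
  set K := V.conjTranspose ⊗ₖ W with hK
  have hKu : K ∈ Matrix.unitaryGroup (Fin 3 × Fin 3) ℂ :=
    Matrix.kronecker_mem_unitary (conjTranspose_mem_unitaryGroup hV) hW
  have hKc : K.conjTranspose = V ⊗ₖ W.conjTranspose := by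
    rw [hK, Matrix.conjTranspose_kronecker, Matrix.conjTranspose_conjTranspose]
  refine ⟨s, hs, hs0, _, normSq_mem_doublyStochastic (mul_mem (conjTranspose_mem_unitaryGroup
    schmidtEigenbasis_mem_unitaryGroup) (mul_mem hKu hU)), ?_⟩
  simp only [Matrix.of_apply]
  rw [← trace_conj_mul_schmidtSwap, ← schmidtVector_quadraticForm, Matrix.conjTranspose_mul]
  have hassoc : K * U * Matrix.diagonal (fun p => ((a p : ℝ) : ℂ)) *
      (U.conjTranspose * K.conjTranspose) = K * (U * Matrix.diagonal (fun p => ((a p : ℝ) : ℂ)) *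
        U.conjTranspose) * K.conjTranspose := by
    simp only [Matrix.mul_assoc]
  rw [hassoc, hKc, hK, partialTranspose_kronecker_mul_mul, hx, Matrix.star_mulVec,
    Matrix.conjTranspose_kronecker, ← Matrix.mulVec_mulVec, ← Matrix.dotProduct_mulVec,
    ← Matrix.mulVec_mulVec]
  rfl

/-- All pairings of the diagonal with the weights of given Schmidt coefficients are attained. -/
theorem exists_unitary_quadraticForm_partialTranspose_eq (a : Fin 3 × Fin 3 → ℝ) (s : Fin 3 → ℝ)
    (σ : Equiv.Perm (Fin 3 × Fin 3)) :
    ∃ U ∈ Matrix.unitaryGroup (Fin 3 × Fin 3) ℂ,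
      star (schmidtVector s) ⬝ᵥ (partialTranspose (U *
        Matrix.diagonal (fun p => ((a p : ℝ) : ℂ)) * U.conjTranspose)).mulVec (schmidtVector s) =
          ((∑ q, schmidtWeight s q * a (σ q) : ℝ) : ℂ) := by
  -- Permuting the eigenvectors makes the overlap with the eigenbasis a permutation matrix.
  refine ⟨schmidtEigenbasis.submatrix id σ.symm,
    submatrix_col_mem_unitaryGroup schmidtEigenbasis_mem_unitaryGroup _, ?_⟩
  rw [schmidtVector_quadraticForm, trace_conj_mul_schmidtSwap]
  have hC : schmidtEigenbasis.conjTranspose * schmidtEigenbasis.submatrix id σ.symm =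
      (1 : Matrix (Fin 3 × Fin 3) (Fin 3 × Fin 3) ℂ).submatrix id σ.symm := by
    rw [← Matrix.mem_unitaryGroup_iff'.1 schmidtEigenbasis_mem_unitaryGroup,
      Matrix.star_eq_conjTranspose]
    rfl
  rw [hC]
  congr 1
  refine Finset.sum_congr rfl fun q _ => ?_
  rw [Finset.sum_eq_single (σ q)]
  · change Complex.normSq ((1 : Matrix (Fin 3 × Fin 3) (Fin 3 × Fin 3) ℂ) q (σ.symm (σ q))) * _ = _
    rw [Equiv.symm_apply_apply, Matrix.one_apply_eq, map_one, one_mul]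
  · intro p _ hp
    have hne : q ≠ σ.symm p := fun h => hp (by simp [h])
    change Complex.normSq ((1 : Matrix (Fin 3 × Fin 3) (Fin 3 × Fin 3) ℂ) q (σ.symm p)) * _ = _
    rw [Matrix.one_apply_ne hne, map_zero, zero_mul]
  · simp

/-! ### Ordered weights and Hildebrand's criterion -/

/-- The eigenvalues of `schmidtSwap s` in non-decreasing order, for non-increasing `s ≥ 0` with
`s 0 * s 2 ≤ s 1 ^ 2`. -/
def sortedWeight₁ (s : Fin 3 → ℝ) : Fin 9 → ℝ :=
  ![-(s 0 * s 1), -(s 0 * s 2), -(s 1 * s 2), s 2 * s 2, s 1 * s 2, s 0 * s 2, s 1 * s 1,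
    s 0 * s 1, s 0 * s 0]

/-- The eigenvalues of `schmidtSwap s` in non-decreasing order, for non-increasing `s ≥ 0` with
`s 1 ^ 2 ≤ s 0 * s 2`. -/
def sortedWeight₂ (s : Fin 3 → ℝ) : Fin 9 → ℝ :=
  ![-(s 0 * s 1), -(s 0 * s 2), -(s 1 * s 2), s 2 * s 2, s 1 * s 2, s 1 * s 1, s 0 * s 2,
    s 0 * s 1, s 0 * s 0]

/-- The enumeration of the index set along which `sortedWeight₁` lists the weights. -/
noncomputable def weightEquiv₁ : Fin 3 × Fin 3 ≃ Fin 9 :=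
  Equiv.ofBijective
    (fun p => (![![8, 7, 5], ![0, 6, 4], ![1, 2, 3]] : Fin 3 → Fin 3 → Fin 9) p.1 p.2) (by decide)

/-- The enumeration of the index set along which `sortedWeight₂` lists the weights. -/
noncomputable def weightEquiv₂ : Fin 3 × Fin 3 ≃ Fin 9 :=
  Equiv.ofBijective
    (fun p => (![![8, 7, 6], ![0, 5, 4], ![1, 2, 3]] : Fin 3 → Fin 3 → Fin 9) p.1 p.2) (by decide)

theorem schmidtWeight_eq₁ (s : Fin 3 → ℝ) (p : Fin 3 × Fin 3) :
    schmidtWeight s p = sortedWeight₁ s (weightEquiv₁ p) := by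
  obtain ⟨i, j⟩ := p
  fin_cases i <;> fin_cases j <;>
    simp [schmidtWeight, sortedWeight₁, weightEquiv₁] <;> exact mul_comm _ _

theorem schmidtWeight_eq₂ (s : Fin 3 → ℝ) (p : Fin 3 × Fin 3) :
    schmidtWeight s p = sortedWeight₂ s (weightEquiv₂ p) := by
  obtain ⟨i, j⟩ := p
  fin_cases i <;> fin_cases j <;>
    simp [schmidtWeight, sortedWeight₂, weightEquiv₂] <;> exact mul_comm _ _

/-- The ordering of `s` decides every comparison of weights except that of `s 1 * s 1` with `s 0 * s
2`, which is the extra hypothesis. -/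
theorem monotone_sortedWeight₁ {s : Fin 3 → ℝ} (hs : Antitone s) (hs0 : ∀ i, 0 ≤ s i)
    (h : s 0 * s 2 ≤ s 1 * s 1) : Monotone (sortedWeight₁ s) := by
  have h01 := hs (show (0 : Fin 3) ≤ 1 by decide)
  have h12 := hs (show (1 : Fin 3) ≤ 2 by decide)
  have h0 := hs0 0
  have h1 := hs0 1
  have h2 := hs0 2
  rw [Fin.monotone_iff_le_succ]
  intro i
  fin_cases i <;> simp [sortedWeight₁] <;> nlinarith

theorem monotone_sortedWeight₂ {s : Fin 3 → ℝ} (hs : Antitone s) (hs0 : ∀ i, 0 ≤ s i)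
    (h : s 1 * s 1 ≤ s 0 * s 2) : Monotone (sortedWeight₂ s) := by
  have h01 := hs (show (0 : Fin 3) ≤ 1 by decide)
  have h12 := hs (show (1 : Fin 3) ≤ 2 by decide)
  have h0 := hs0 0
  have h1 := hs0 1
  have h2 := hs0 2
  rw [Fin.monotone_iff_le_succ]
  intro i
  fin_cases i <;> simp [sortedWeight₂] <;> nlinarith

/-- Hildebrand's criterion, necessity. -/
theorem sum_mul_sortedWeight_nonneg {l : Fin (3 * 3) → ℝ}
    (hl : (diagMat l : Matrix (Fin 3 × Fin 3) (Fin 3 × Fin 3) ℂ) ∈ AbsPPT 3 3)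
    (s : Fin 3 → ℝ) :
    0 ≤ ∑ k, l k * sortedWeight₁ s k ∧ 0 ≤ ∑ k, l k * sortedWeight₂ s k := by
  -- Every enumeration is realized by some unitary, so no ordering or sign of `s` is needed.
  have key : ∀ e : Fin 3 × Fin 3 ≃ Fin (3 * 3), 0 ≤ ∑ q, schmidtWeight s q * l (e q) := by
    intro e
    obtain ⟨U, hU, h⟩ := exists_unitary_quadraticForm_partialTranspose_eq
      (fun p => l (finProdFinEquiv p)) s (e.trans finProdFinEquiv.symm)
    have hp := (hl.2 U hU).dotProduct_mulVec_nonneg (schmidtVector s)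
    rw [diagMat, h] at hp
    have hp' := Complex.zero_le_real.1 hp
    simpa using hp'
  refine ⟨(key weightEquiv₁).trans_eq ?_, (key weightEquiv₂).trans_eq ?_⟩
  · rw [← Equiv.sum_comp weightEquiv₁]
    exact Finset.sum_congr rfl fun q _ => by rw [schmidtWeight_eq₁, mul_comm]
  · rw [← Equiv.sum_comp weightEquiv₂]
    exact Finset.sum_congr rfl fun q _ => by rw [schmidtWeight_eq₂, mul_comm]

theorem antivary_comp_of_monotone_of_antitone {ι κ : Type*} [LinearOrder κ] {f g : κ → ℝ} (hf : Monotone f)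
    (hg : Antitone g) (e : ι → κ) : Antivary (fun i => f (e i)) (fun i => g (e i)) := by
  intro i j hij
  exact hf (le_of_lt (hg.reflect_lt hij))

/-- Hildebrand's criterion, sufficiency. -/
theorem diagMat_mem_absPPT {l : Fin (3 * 3) → ℝ} (hl : Antitone l) (hsum : ∑ k, l k = 1)
    (h₁ : ∀ s : Fin 3 → ℝ, Antitone s → (∀ i, 0 ≤ s i) → s 0 * s 2 ≤ s 1 * s 1 →
      0 ≤ ∑ k, l k * sortedWeight₁ s k)
    (h₂ : ∀ s : Fin 3 → ℝ, Antitone s → (∀ i, 0 ≤ s i) → s 1 * s 1 ≤ s 0 * s 2 →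
      0 ≤ ∑ k, l k * sortedWeight₂ s k) :
    (diagMat l : Matrix (Fin 3 × Fin 3) (Fin 3 × Fin 3) ℂ) ∈ AbsPPT 3 3 := by
  -- A product vector as test vector isolates the last, hence smallest, entry.
  have hlast : 0 ≤ l 8 := by
    have h := h₁ ![1, 0, 0] (by rw [Fin.antitone_iff_succ_le]; intro i; fin_cases i <;> simp)
      (by intro i; fin_cases i <;> simp) (by simp)
    simpa [sortedWeight₁, Fin.sum_univ_succ] using h
  have hps : (diagMat l : Matrix (Fin 3 × Fin 3) (Fin 3 × Fin 3) ℂ).PosSemidef := by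
    refine Matrix.PosSemidef.diagonal fun p => ?_
    exact Complex.zero_le_real.2 (hlast.trans (hl (Fin.le_last _)))
  refine ⟨⟨hps, ?_⟩, fun U hU => ?_⟩
  · rw [diagMat, Matrix.trace_diagonal, ← Complex.ofReal_sum, Equiv.sum_comp finProdFinEquiv l,
      hsum, Complex.ofReal_one]
  · refine Matrix.PosSemidef.of_dotProduct_mulVec_nonneg (partialTranspose_isHermitian
      (hps.mul_mul_conjTranspose_same U).isHermitian) fun x => ?_
    obtain ⟨s, hs, hs0, M, hM, h⟩ := exists_quadraticForm_partialTranspose_eq hU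
      (fun p => l (finProdFinEquiv p)) x
    rw [diagMat, h]
    refine Complex.zero_le_real.2 ?_
    -- By rearrangement, the oppositely ordered pairing bounds every doubly stochastic pairing from
    -- below.
    have key : ∀ (v : Fin 9 → ℝ) (e : Fin 3 × Fin 3 ≃ Fin (3 * 3)),
        (∀ p, schmidtWeight s p = v (e p)) → Monotone v → 0 ≤ ∑ k, l k * v k →
        0 ≤ ∑ q, ∑ p, M q p * (schmidtWeight s q * l (finProdFinEquiv p)) := by
      intro v e hve hv h0
      let τ : Equiv.Perm (Fin 3 × Fin 3) := finProdFinEquiv.trans e.symm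
      have hM' : M.submatrix id τ.symm ∈ doublyStochastic ℝ (Fin 3 × Fin 3) := by
        rw [← reindex_mem_doublyStochastic_iff (e₁ := Equiv.refl _) (e₂ := τ)] at hM
        exact hM
      have hr := (antivary_comp_of_monotone_of_antitone hv hl e).sum_mul_le_sum_doublyStochastic hM'
      rw [← Equiv.sum_comp e] at h0
      refine h0.trans ((le_of_eq ?_).trans (hr.trans_eq ?_))
      · exact Finset.sum_congr rfl fun q _ => mul_comm _ _
      · refine Finset.sum_congr rfl fun q _ => ?_
        rw [← Equiv.sum_comp τ]
        exact Finset.sum_congr rfl fun p _ => by simp [τ, hve]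
    rcases le_total (s 0 * s 2) (s 1 * s 1) with hle | hle
    · exact key _ _ (schmidtWeight_eq₁ s) (monotone_sortedWeight₁ hs hs0 hle) (h₁ s hs hs0 hle)
    · exact key _ _ (schmidtWeight_eq₂ s) (monotone_sortedWeight₂ hs hs0 hle) (h₂ s hs hs0 hle)

/-- The two forms differ only by exchanging `l 5` and `l 6`, so they agree where `s 0 * s 2 = s 1 *
s 1`. -/
theorem sum_mul_sortedWeight₁ (l : Fin 9 → ℝ) (s : Fin 3 → ℝ) :
    ∑ k, l k * sortedWeight₁ s k = l 8 * (s 0 * s 0) + l 6 * (s 1 * s 1) + l 3 * (s 2 * s 2) +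
      (l 7 - l 0) * (s 0 * s 1) + (l 5 - l 1) * (s 0 * s 2) + (l 4 - l 2) * (s 1 * s 2) := by
  simp [sortedWeight₁, Fin.sum_univ_succ]
  ring

theorem sum_mul_sortedWeight₂ (l : Fin 9 → ℝ) (s : Fin 3 → ℝ) :
    ∑ k, l k * sortedWeight₂ s k = l 8 * (s 0 * s 0) + l 5 * (s 1 * s 1) + l 3 * (s 2 * s 2) +
      (l 7 - l 0) * (s 0 * s 1) + (l 6 - l 1) * (s 0 * s 2) + (l 4 - l 2) * (s 1 * s 2) := by
  simp [sortedWeight₂, Fin.sum_univ_succ]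
  ring

/-! ### Boundary points and zeros of the forms -/

/-- The normalized Schmidt coefficient vectors. -/
def schmidtSimplex : Set (Fin 3 → ℝ) :=
  {s | Antitone s ∧ (∀ i, 0 ≤ s i) ∧ s 0 * s 0 + s 1 * s 1 + s 2 * s 2 = 1}

theorem isCompact_schmidtSimplex : IsCompact schmidtSimplex := by
  have hc : IsClosed schmidtSimplex := by
    have h1 : IsClosed {s : Fin 3 → ℝ | Antitone s} := by
      simp only [Antitone, Set.ofPred_forall]
      exact isClosed_iInter fun i => isClosed_iInter fun j => isClosed_iInter fun _ =>
        isClosed_le (continuous_apply j) (continuous_apply i)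
    have h2 : IsClosed {s : Fin 3 → ℝ | ∀ i, 0 ≤ s i} := by
      simp only [Set.ofPred_forall]
      exact isClosed_iInter fun i => isClosed_le continuous_const (continuous_apply i)
    exact h1.inter (h2.inter (isClosed_eq (by fun_prop) continuous_const))
  refine (isCompact_univ_pi fun _ : Fin 3 => isCompact_Icc (a := (0 : ℝ)) (b := 1)).of_isClosed_subset
    hc fun s hs i _ => ⟨hs.2.1 i, ?_⟩
  have h := hs.2.2
  have h0 := mul_self_nonneg (s 0)
  have h1 := mul_self_nonneg (s 1)
  have h2 := mul_self_nonneg (s 2)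
  have hi : s i * s i ≤ 1 := by fin_cases i <;> simp <;> linarith
  nlinarith [hs.2.1 i]

theorem sum_eq_one_of_diagMat_mem_absPPT {m n : ℕ} {l : Fin (m * n) → ℝ}
    (hl : diagMat l ∈ AbsPPT m n) : ∑ k, l k = 1 := by
  have ht := hl.1.2
  rw [diagMat, Matrix.trace_diagonal, ← Complex.ofReal_sum, Equiv.sum_comp finProdFinEquiv l] at ht
  exact_mod_cast ht

/-- If both forms are bounded below by a positive multiple of the squared norm on non-increasing
non-negative vectors, then the corresponding state is an interior point. -/
theorem isAbsPPTInterior_of_forall_schmidtSimplex {l : Fin (3 * 3) → ℝ} (hl : Antitone l)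
    (hAP : (diagMat l : Matrix (Fin 3 × Fin 3) (Fin 3 × Fin 3) ℂ) ∈ AbsPPT 3 3) {m : ℝ} (hm : 0 < m)
    (h : ∀ s ∈ schmidtSimplex,
      m ≤ ∑ k, l k * sortedWeight₁ s k ∧ m ≤ ∑ k, l k * sortedWeight₂ s k) :
    IsAbsPPTInterior (diagMat l : Matrix (Fin 3 × Fin 3) (Fin 3 × Fin 3) ℂ) := by
  have hsum : ∑ k, l k = 1 := sum_eq_one_of_diagMat_mem_absPPT hAP
  have hnn : ∀ s : Fin 3 → ℝ, 0 ≤ s 0 * s 0 + s 1 * s 1 + s 2 * s 2 := fun s =>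
    add_nonneg (add_nonneg (mul_self_nonneg _) (mul_self_nonneg _)) (mul_self_nonneg _)
  -- Both forms are homogeneous of degree two, so the bound extends from unit vectors.
  have hscale : ∀ s : Fin 3 → ℝ, Antitone s → (∀ i, 0 ≤ s i) →
      m * (s 0 * s 0 + s 1 * s 1 + s 2 * s 2) ≤ ∑ k, l k * sortedWeight₁ s k ∧
      m * (s 0 * s 0 + s 1 * s 1 + s 2 * s 2) ≤ ∑ k, l k * sortedWeight₂ s k := by
    intro s hs hs0
    set N := s 0 * s 0 + s 1 * s 1 + s 2 * s 2 with hN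
    rcases (hnn s).eq_or_lt with h0 | hpos
    · rw [hN, ← h0, mul_zero]
      exact sum_mul_sortedWeight_nonneg hAP s
    · have hr : 0 < √N := Real.sqrt_pos.2 hpos
      have hrr : √N * √N = N := Real.mul_self_sqrt hpos.le
      have hmem : (fun i => s i / √N) ∈ schmidtSimplex := by
        refine ⟨fun i j hij => div_le_div_of_nonneg_right (hs hij) hr.le,
          fun i => div_nonneg (hs0 i) hr.le, ?_⟩
        simp only [div_mul_div_comm, hrr]
        rw [← add_div, ← add_div, ← hN, div_self hpos.ne']
      have hq := h _ hmem
      rw [sum_mul_sortedWeight₁, sum_mul_sortedWeight₂] at hq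
      rw [sum_mul_sortedWeight₁, sum_mul_sortedWeight₂]
      simp only [div_mul_div_comm, hrr] at hq
      simp only [mul_div_assoc', ← add_div] at hq
      rw [le_div_iff₀ hpos, le_div_iff₀ hpos] at hq
      exact hq
  -- Removing `ε / 9` from each entry lowers both forms by `ε / 9` times the squared norm, which `ε
  -- ≤ m` affords; the bound `1 / 2` keeps `ε < 1`.
  set ε : ℝ := min (1 / 2) m with hε
  have hε0 : 0 < ε := lt_min (by norm_num) hm
  have hε1 : ε < 1 := (min_le_left _ _).trans_lt (by norm_num)
  have hεm : ε ≤ m := min_le_right _ _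
  have hpos : 0 < 1 - ε := by linarith
  refine ⟨hAP, ε, hε0, hε1, ?_⟩
  have heq : (1 / (1 - ε)) • ((diagMat l : Matrix (Fin 3 × Fin 3) (Fin 3 × Fin 3) ℂ) -
      ε • ((1 / (((3 : ℕ) : ℝ) * ((3 : ℕ) : ℝ))) •
        (1 : Matrix (Fin 3 × Fin 3) (Fin 3 × Fin 3) ℂ))) =
      diagMat (fun k => (l k - ε / 9) / (1 - ε)) := by
    ext p q
    by_cases hpq : p = q
    · subst hpq
      simp [diagMat]
      ring
    · simp [diagMat, hpq]
  rw [heq]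
  have hw₁ : ∀ s : Fin 3 → ℝ, ∑ k, (l k - ε / 9) / (1 - ε) * sortedWeight₁ s k =
      (∑ k, l k * sortedWeight₁ s k - ε / 9 * (s 0 * s 0 + s 1 * s 1 + s 2 * s 2)) / (1 - ε) := by
    intro s
    rw [sum_mul_sortedWeight₁ (fun k => (l k - ε / 9) / (1 - ε)), sum_mul_sortedWeight₁]
    ring
  have hw₂ : ∀ s : Fin 3 → ℝ, ∑ k, (l k - ε / 9) / (1 - ε) * sortedWeight₂ s k =
      (∑ k, l k * sortedWeight₂ s k - ε / 9 * (s 0 * s 0 + s 1 * s 1 + s 2 * s 2)) / (1 - ε) := by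
    intro s
    rw [sum_mul_sortedWeight₂ (fun k => (l k - ε / 9) / (1 - ε)), sum_mul_sortedWeight₂]
    ring
  have hle : ∀ s : Fin 3 → ℝ, ε / 9 * (s 0 * s 0 + s 1 * s 1 + s 2 * s 2) ≤
      m * (s 0 * s 0 + s 1 * s 1 + s 2 * s 2) := fun s =>
    mul_le_mul_of_nonneg_right (by linarith) (hnn s)
  refine diagMat_mem_absPPT
    (fun i j hij => div_le_div_of_nonneg_right (by linarith [hl hij]) hpos.le) ?_ ?_ ?_
  · rw [← Finset.sum_div, Finset.sum_sub_distrib, hsum]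
    simp
    field_simp
  · intro s hs hs0 _
    rw [hw₁]
    exact div_nonneg (by linarith [hle s, (hscale s hs hs0).1]) hpos.le
  · intro s hs hs0 _
    rw [hw₂]
    exact div_nonneg (by linarith [hle s, (hscale s hs hs0).2]) hpos.le

/-- For a boundary point, the form attaining the minimum vanishes at some normalized vector. -/
theorem IsAbsPPTBoundary.exists_sum_mul_sortedWeight_eq_zero {l : Fin (3 * 3) → ℝ}
    (hl : Antitone l)
    (hρ : IsAbsPPTBoundary (diagMat l : Matrix (Fin 3 × Fin 3) (Fin 3 × Fin 3) ℂ)) :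
    ∃ s ∈ schmidtSimplex,
      (s 0 * s 2 ≤ s 1 * s 1 ∧ ∑ k, l k * sortedWeight₁ s k = 0) ∨
      (s 1 * s 1 ≤ s 0 * s 2 ∧ ∑ k, l k * sortedWeight₂ s k = 0) := by
  have hne : schmidtSimplex.Nonempty :=
    ⟨![1, 0, 0], by rw [Fin.antitone_iff_succ_le]; intro i; fin_cases i <;> simp,
      by intro i; fin_cases i <;> simp, by simp⟩
  have hcont : ContinuousOn (fun s : Fin 3 → ℝ =>
      min (∑ k, l k * sortedWeight₁ s k) (∑ k, l k * sortedWeight₂ s k)) schmidtSimplex := by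
    refine Continuous.continuousOn ?_
    have e₁ : (fun s : Fin 3 → ℝ => ∑ k, l k * sortedWeight₁ s k) = _ :=
      funext fun s => sum_mul_sortedWeight₁ l s
    have e₂ : (fun s : Fin 3 → ℝ => ∑ k, l k * sortedWeight₂ s k) = _ :=
      funext fun s => sum_mul_sortedWeight₂ l s
    refine Continuous.min ?_ ?_
    · rw [e₁]; fun_prop
    · rw [e₂]; fun_prop
  obtain ⟨s, hs, hmin⟩ := isCompact_schmidtSimplex.exists_isMinOn hne hcont
  have hnn := sum_mul_sortedWeight_nonneg hρ.1 s
  have hle : min (∑ k, l k * sortedWeight₁ s k) (∑ k, l k * sortedWeight₂ s k) ≤ 0 := by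
    by_contra hpos
    refine hρ.2 (isAbsPPTInterior_of_forall_schmidtSimplex hl hρ.1 (not_le.1 hpos) fun t ht => ?_)
    exact ⟨(hmin ht).trans (min_le_left _ _), (hmin ht).trans (min_le_right _ _)⟩
  -- The first form minus the second is `(l 5 - l 6) * (s 0 * s 2 - s 1 * s 1)`, so the smaller form
  -- is the one whose weights are correctly sorted at `s`.
  have h56 : l 6 ≤ l 5 := hl (by decide)
  have e₁ := sum_mul_sortedWeight₁ l s
  have e₂ := sum_mul_sortedWeight₂ l s
  refine ⟨s, hs, ?_⟩
  rcases le_total (s 0 * s 2) (s 1 * s 1) with h | h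
  · refine Or.inl ⟨h, le_antisymm ?_ hnn.1⟩
    rcases min_le_iff.1 hle with h' | h'
    · exact h'
    · rw [e₂] at h'
      rw [e₁]
      nlinarith [mul_nonneg (sub_nonneg.2 h56) (sub_nonneg.2 h)]
  · refine Or.inr ⟨h, le_antisymm ?_ hnn.2⟩
    rcases min_le_iff.1 hle with h' | h'
    · rw [e₁] at h'
      rw [e₂]
      nlinarith [mul_nonneg (sub_nonneg.2 h56) (sub_nonneg.2 h)]
    · exact h'

/-! ### Gradients, majorization and Abel summation -/

/-- A ternary quadratic form that is nonnegative everywhere has zero gradient at its zeros. -/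
theorem ternary_gradient_eq_zero {A B C D E F x y z : ℝ}
    (h : ∀ x y z : ℝ, 0 ≤ A * (x * x) + B * (y * y) + C * (z * z) + D * (x * y) + E * (x * z) +
      F * (y * z))
    (h0 : A * (x * x) + B * (y * y) + C * (z * z) + D * (x * y) + E * (x * z) + F * (y * z) = 0) :
    2 * A * x + D * y + E * z = 0 ∧ D * x + 2 * B * y + F * z = 0 ∧
      E * x + F * y + 2 * C * z = 0 := by
  -- Along each coordinate axis through the zero the form has no constant term, so its discriminant
  -- is `g ^ 2`.
  have key : ∀ a g : ℝ, (∀ t : ℝ, 0 ≤ a * (t * t) + g * t + 0) → g = 0 := by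
    intro a g hg
    have := discrim_le_zero hg
    rw [discrim] at this
    nlinarith
  refine ⟨key A _ fun t => ?_, key B _ fun t => ?_, key C _ fun t => ?_⟩
  · linarith [h (x + t) y z]
  · linarith [h x (y + t) z]
  · linarith [h x y (z + t)]

/-- Nonnegativity holds for all real `s`, so a zero is an unconstrained minimum even on the edge of
the ordered cone. -/
theorem gradient_sortedWeight₁ {l : Fin 9 → ℝ} (h : ∀ s, 0 ≤ ∑ k, l k * sortedWeight₁ s k)
    {s : Fin 3 → ℝ} (h0 : ∑ k, l k * sortedWeight₁ s k = 0) :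
    2 * l 8 * s 0 + (l 7 - l 0) * s 1 + (l 5 - l 1) * s 2 = 0 ∧
    (l 7 - l 0) * s 0 + 2 * l 6 * s 1 + (l 4 - l 2) * s 2 = 0 ∧
    (l 5 - l 1) * s 0 + (l 4 - l 2) * s 1 + 2 * l 3 * s 2 = 0 := by
  rw [sum_mul_sortedWeight₁] at h0
  exact ternary_gradient_eq_zero
    (fun x y z => by simpa using (h ![x, y, z]).trans_eq (sum_mul_sortedWeight₁ l _)) h0

theorem gradient_sortedWeight₂ {l : Fin 9 → ℝ} (h : ∀ s, 0 ≤ ∑ k, l k * sortedWeight₂ s k)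
    {s : Fin 3 → ℝ} (h0 : ∑ k, l k * sortedWeight₂ s k = 0) :
    2 * l 8 * s 0 + (l 7 - l 0) * s 1 + (l 6 - l 1) * s 2 = 0 ∧
    (l 7 - l 0) * s 0 + 2 * l 5 * s 1 + (l 4 - l 2) * s 2 = 0 ∧
    (l 6 - l 1) * s 0 + (l 4 - l 2) * s 1 + 2 * l 3 * s 2 = 0 := by
  rw [sum_mul_sortedWeight₂] at h0
  exact ternary_gradient_eq_zero
    (fun x y z => by simpa using (h ![x, y, z]).trans_eq (sum_mul_sortedWeight₂ l _)) h0

/-- `n` majorizes `l`, for non-increasing `n` and `l`: the pairing of `n` with any non-decreasing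
vector is at most that of `l`. -/
def Majorizes (n l : Fin 9 → ℝ) : Prop :=
  ∀ w : Fin 9 → ℝ, Monotone w → ∑ k, n k * w k ≤ ∑ k, l k * w k

/-- The partial sums of the difference are nonnegative, and the totals agree. -/
theorem Majorizes.partial_sums {n l : Fin 9 → ℝ} (h : Majorizes n l) :
    ∃ d : Fin 9 → ℝ, n = l + d ∧
    0 ≤ d 0 ∧ 0 ≤ d 0 + d 1 ∧ 0 ≤ d 0 + d 1 + d 2 ∧ 0 ≤ d 0 + d 1 + d 2 + d 3 ∧
    0 ≤ d 0 + d 1 + d 2 + d 3 + d 4 ∧ 0 ≤ d 0 + d 1 + d 2 + d 3 + d 4 + d 5 ∧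
    0 ≤ d 0 + d 1 + d 2 + d 3 + d 4 + d 5 + d 6 ∧
    0 ≤ d 0 + d 1 + d 2 + d 3 + d 4 + d 5 + d 6 + d 7 ∧
    d 0 + d 1 + d 2 + d 3 + d 4 + d 5 + d 6 + d 7 + d 8 = 0 := by
  have key : ∀ w : Fin 9 → ℝ, (∀ i : Fin 8, w i.castSucc ≤ w i.succ) →
      ∑ k, (n k - l k) * w k ≤ 0 := by
    intro w hw
    have := h w (Fin.monotone_iff_le_succ.2 hw)
    simp only [sub_mul, Finset.sum_sub_distrib]
    linarith
  refine ⟨fun k => n k - l k, by ext k; simp, ?_⟩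
  -- Negated indicators of initial segments are monotone and test the partial sums; the two constant
  -- vectors fix the total.
  have h1 := key ![-1, 0, 0, 0, 0, 0, 0, 0, 0] (by intro i; fin_cases i <;> simp)
  have h2 := key ![-1, -1, 0, 0, 0, 0, 0, 0, 0] (by intro i; fin_cases i <;> simp)
  have h3 := key ![-1, -1, -1, 0, 0, 0, 0, 0, 0] (by intro i; fin_cases i <;> simp)
  have h4 := key ![-1, -1, -1, -1, 0, 0, 0, 0, 0] (by intro i; fin_cases i <;> simp)
  have h5 := key ![-1, -1, -1, -1, -1, 0, 0, 0, 0] (by intro i; fin_cases i <;> simp)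
  have h6 := key ![-1, -1, -1, -1, -1, -1, 0, 0, 0] (by intro i; fin_cases i <;> simp)
  have h7 := key ![-1, -1, -1, -1, -1, -1, -1, 0, 0] (by intro i; fin_cases i <;> simp)
  have h8 := key ![-1, -1, -1, -1, -1, -1, -1, -1, 0] (by intro i; fin_cases i <;> simp)
  have h9 := key ![-1, -1, -1, -1, -1, -1, -1, -1, -1] (by intro i; fin_cases i <;> simp)
  have h10 := key ![1, 1, 1, 1, 1, 1, 1, 1, 1] (by intro i; fin_cases i <;> simp)
  simp [Fin.sum_univ_succ] at h1 h2 h3 h4 h5 h6 h7 h8 h9 h10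
  refine ⟨?_, ?_, ?_, ?_, ?_, ?_, ?_, ?_, ?_⟩ <;> linarith

theorem eq_zero_of_fin_nine {d : Fin 9 → ℝ} (h0 : d 0 = 0) (h1 : d 1 = 0) (h2 : d 2 = 0)
    (h3 : d 3 = 0) (h4 : d 4 = 0) (h5 : d 5 = 0) (h6 : d 6 = 0) (h7 : d 7 = 0) (h8 : d 8 = 0) :
    d = 0 := by
  ext k
  fin_cases k <;> assumption

/-- In an Abel sum with nonnegative terms that is nonnegative after negation, every term vanishes. -/
theorem abel_terms_eq_zero {d w : Fin 9 → ℝ} (hw : Monotone w)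
    (h1 : 0 ≤ d 0) (h2 : 0 ≤ d 0 + d 1) (h3 : 0 ≤ d 0 + d 1 + d 2)
    (h4 : 0 ≤ d 0 + d 1 + d 2 + d 3) (h5 : 0 ≤ d 0 + d 1 + d 2 + d 3 + d 4)
    (h6 : 0 ≤ d 0 + d 1 + d 2 + d 3 + d 4 + d 5)
    (h7 : 0 ≤ d 0 + d 1 + d 2 + d 3 + d 4 + d 5 + d 6)
    (h8 : 0 ≤ d 0 + d 1 + d 2 + d 3 + d 4 + d 5 + d 6 + d 7)
    (h9 : d 0 + d 1 + d 2 + d 3 + d 4 + d 5 + d 6 + d 7 + d 8 = 0)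
    (h : 0 ≤ ∑ k, d k * w k) :
    d 0 * (w 1 - w 0) = 0 ∧ (d 0 + d 1) * (w 2 - w 1) = 0 ∧
    (d 0 + d 1 + d 2) * (w 3 - w 2) = 0 ∧ (d 0 + d 1 + d 2 + d 3) * (w 4 - w 3) = 0 ∧
    (d 0 + d 1 + d 2 + d 3 + d 4) * (w 5 - w 4) = 0 ∧
    (d 0 + d 1 + d 2 + d 3 + d 4 + d 5) * (w 6 - w 5) = 0 ∧
    (d 0 + d 1 + d 2 + d 3 + d 4 + d 5 + d 6) * (w 7 - w 6) = 0 ∧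
    (d 0 + d 1 + d 2 + d 3 + d 4 + d 5 + d 6 + d 7) * (w 8 - w 7) = 0 := by
  have g1 := mul_nonneg h1 (sub_nonneg.2 (hw (show (0 : Fin 9) ≤ 1 by decide)))
  have g2 := mul_nonneg h2 (sub_nonneg.2 (hw (show (1 : Fin 9) ≤ 2 by decide)))
  have g3 := mul_nonneg h3 (sub_nonneg.2 (hw (show (2 : Fin 9) ≤ 3 by decide)))
  have g4 := mul_nonneg h4 (sub_nonneg.2 (hw (show (3 : Fin 9) ≤ 4 by decide)))
  have g5 := mul_nonneg h5 (sub_nonneg.2 (hw (show (4 : Fin 9) ≤ 5 by decide)))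
  have g6 := mul_nonneg h6 (sub_nonneg.2 (hw (show (5 : Fin 9) ≤ 6 by decide)))
  have g7 := mul_nonneg h7 (sub_nonneg.2 (hw (show (6 : Fin 9) ≤ 7 by decide)))
  have g8 := mul_nonneg h8 (sub_nonneg.2 (hw (show (7 : Fin 9) ≤ 8 by decide)))
  have habel : d 0 * (w 1 - w 0) + (d 0 + d 1) * (w 2 - w 1) + (d 0 + d 1 + d 2) * (w 3 - w 2) +
      (d 0 + d 1 + d 2 + d 3) * (w 4 - w 3) + (d 0 + d 1 + d 2 + d 3 + d 4) * (w 5 - w 4) +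
      (d 0 + d 1 + d 2 + d 3 + d 4 + d 5) * (w 6 - w 5) +
      (d 0 + d 1 + d 2 + d 3 + d 4 + d 5 + d 6) * (w 7 - w 6) +
      (d 0 + d 1 + d 2 + d 3 + d 4 + d 5 + d 6 + d 7) * (w 8 - w 7) + ∑ k, d k * w k =
      (d 0 + d 1 + d 2 + d 3 + d 4 + d 5 + d 6 + d 7 + d 8) * w 8 := by
    simp [Fin.sum_univ_succ]
    ring
  rw [h9, zero_mul] at habel
  refine ⟨?_, ?_, ?_, ?_, ?_, ?_, ?_, ?_⟩ <;> linarith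

theorem eq_zero_of_mul_eq_zero_of_pos {a x : ℝ} (hx : 0 < x) (h : a * x = 0) : a = 0 :=
  (mul_eq_zero.1 h).resolve_right hx.ne'

/-- Splits one gradient equation into two once inequalities give both coefficients a sign. -/
theorem eq_zero_of_nonpos_combination {a b x y : ℝ} (ha : a ≤ 0) (hb : b ≤ 0) (hx : 0 < x)
    (hy : 0 < y) (h : a * x + b * y = 0) : a = 0 ∧ b = 0 := by
  have h1 := mul_nonpos_of_nonpos_of_nonneg ha hx.le
  have h2 := mul_nonpos_of_nonpos_of_nonneg hb hy.le
  exact ⟨eq_zero_of_mul_eq_zero_of_pos hx (by linarith),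
    eq_zero_of_mul_eq_zero_of_pos hy (by linarith)⟩

/-- A majorizing vector on which both forms are nonnegative coincides with the given vector, if
the first form vanishes at some normalized vector where it is the smaller one. -/
theorem Majorizes.eq_of_sortedWeight₁ {n l : Fin 9 → ℝ} (hnl : Majorizes n l) (hl : Antitone l)
    (hn : Antitone n) (hl₁ : ∀ s, 0 ≤ ∑ k, l k * sortedWeight₁ s k)
    (hl₂ : ∀ s, 0 ≤ ∑ k, l k * sortedWeight₂ s k) (hn₁ : ∀ s, 0 ≤ ∑ k, n k * sortedWeight₁ s k)
    (hn₂ : ∀ s, 0 ≤ ∑ k, n k * sortedWeight₂ s k) {s : Fin 3 → ℝ} (hs : s ∈ schmidtSimplex)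
    (hle : s 0 * s 2 ≤ s 1 * s 1) (h0 : ∑ k, l k * sortedWeight₁ s k = 0) : n = l := by
  have hmono := monotone_sortedWeight₁ hs.1 hs.2.1 hle
  have hn0 : ∑ k, n k * sortedWeight₁ s k = 0 :=
    le_antisymm ((hnl _ hmono).trans_eq h0) (hn₁ s)
  obtain ⟨d, hd, D1, D2, D3, D4, D5, D6, D7, D8, D9⟩ := hnl.partial_sums
  have hd0 : 0 ≤ ∑ k, d k * sortedWeight₁ s k := by
    have : ∑ k, n k * sortedWeight₁ s k = ∑ k, l k * sortedWeight₁ s k +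
        ∑ k, d k * sortedWeight₁ s k := by
      rw [hd, ← Finset.sum_add_distrib]
      exact Finset.sum_congr rfl fun k _ => add_mul _ _ _
    linarith
  obtain ⟨A1, A2, A3, A4, A5, A6, A7, A8⟩ := abel_terms_eq_zero hmono D1 D2 D3 D4 D5 D6 D7 D8 D9 hd0
  obtain ⟨gl1, gl2, gl3⟩ := gradient_sortedWeight₁ hl₁ h0
  obtain ⟨gn1, gn2, gn3⟩ := gradient_sortedWeight₁ hn₁ hn0
  -- Where the two forms agree, the second also vanishes and contributes its own gradient equations.
  have hg2 : s 0 * s 2 = s 1 * s 1 → ∑ k, l k * sortedWeight₂ s k = 0 ∧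
      ∑ k, n k * sortedWeight₂ s k = 0 := by
    intro h
    rw [sum_mul_sortedWeight₁] at h0 hn0
    rw [sum_mul_sortedWeight₂, sum_mul_sortedWeight₂]
    exact ⟨by linear_combination h0 + (l 6 - l 5) * h, by linear_combination hn0 + (n 6 - n 5) * h⟩
  have hnk : ∀ k, n k = l k + d k := fun k => by rw [hd]; rfl
  suffices d = 0 by rw [hd, this, add_zero]
  have l01 := hl (show (0 : Fin 9) ≤ 1 by decide)
  have l12 := hl (show (1 : Fin 9) ≤ 2 by decide)
  have l23 := hl (show (2 : Fin 9) ≤ 3 by decide)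
  have l34 := hl (show (3 : Fin 9) ≤ 4 by decide)
  have l45 := hl (show (4 : Fin 9) ≤ 5 by decide)
  have l56 := hl (show (5 : Fin 9) ≤ 6 by decide)
  have l67 := hl (show (6 : Fin 9) ≤ 7 by decide)
  have l78 := hl (show (7 : Fin 9) ≤ 8 by decide)
  have n01 := hn (show (0 : Fin 9) ≤ 1 by decide)
  have n12 := hn (show (1 : Fin 9) ≤ 2 by decide)
  have n23 := hn (show (2 : Fin 9) ≤ 3 by decide)
  have n34 := hn (show (3 : Fin 9) ≤ 4 by decide)
  have n45 := hn (show (4 : Fin 9) ≤ 5 by decide)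
  have n56 := hn (show (5 : Fin 9) ≤ 6 by decide)
  have n67 := hn (show (6 : Fin 9) ≤ 7 by decide)
  have n78 := hn (show (7 : Fin 9) ≤ 8 by decide)
  have s01 := hs.1 (show (0 : Fin 3) ≤ 1 by decide)
  have s12 := hs.1 (show (1 : Fin 3) ≤ 2 by decide)
  have s2 := hs.2.1 2
  have hnorm := hs.2.2
  have hgl := fun h => gradient_sortedWeight₂ hl₂ (hg2 h).1
  have hgn := fun h => gradient_sortedWeight₂ hn₂ (hg2 h).2
  clear hn0 hd0 hg2 hl₁ hl₂ hn₁ hn₂ h0 hmono hnl hs hl hn hd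
  simp only [sortedWeight₁, Matrix.cons_val] at A1 A2 A3 A4 A5 A6 A7 A8
  simp only [hnk] at gn1 gn2 gn3 hgn n01 n12 n23 n34 n45 n56 n67 n78
  clear hnk
  generalize s 0 = x at *
  generalize s 1 = y at *
  generalize s 2 = z at *
  have hx : 0 < x := by
    refine lt_of_le_of_ne (s2.trans (s12.trans s01)) fun hx => ?_
    have hy : y = 0 := le_antisymm (s01.trans hx.ge) (s2.trans s12)
    have hz : z = 0 := le_antisymm (s12.trans hy.le) s2
    rw [← hx, hy, hz] at hnorm
    norm_num at hnorm
  clear hnorm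
  rcases (s2.trans s12).eq_or_lt with hy | hy
  -- At a product vector the gradients force the first eight entries to be equal and the last to
  -- vanish, for `l` and for `n`; the total then gives `d = 0`.
  · obtain rfl : z = 0 := le_antisymm (s12.trans hy.ge) s2
    subst hy
    have e1 : l 8 = 0 := eq_zero_of_mul_eq_zero_of_pos hx (by linarith only [gl1])
    have e2 : l 8 + d 8 = 0 := eq_zero_of_mul_eq_zero_of_pos hx (by linarith only [gn1])
    have e3 : l 7 - l 0 = 0 := eq_zero_of_mul_eq_zero_of_pos hx (by linarith only [gl2])
    have e4 : l 7 + d 7 - (l 0 + d 0) = 0 :=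
      eq_zero_of_mul_eq_zero_of_pos hx (by linarith only [gn2])
    clear A1 A2 A3 A4 A5 A6 A7 A8 gl1 gl2 gl3 gn1 gn2 gn3 hgl hgn
    apply eq_zero_of_fin_nine <;> linarith
  rcases s2.eq_or_lt with hz | hz
  · subst hz
    -- With `z = 0`, the third gradient component makes entries 1 to 5 equal in both vectors.
    have el := (eq_zero_of_nonpos_combination (a := l 5 - l 1) (b := l 4 - l 2)
      (by linarith only [l12, l23, l34, l45]) (by linarith only [l23, l34]) hx hy (by linarith only [gl3])).1
    have en := (eq_zero_of_nonpos_combination (a := l 5 + d 5 - (l 1 + d 1))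
      (b := l 4 + d 4 - (l 2 + d 2)) (by linarith only [n12, n23, n34, n45])
      (by linarith only [n23, n34]) hx hy (by linarith only [gn3])).1
    have a1 : d 0 = 0 := by
      refine eq_zero_of_mul_eq_zero_of_pos ?_ A1
      linarith only [mul_pos hx hy]
    have a6 : d 0 + d 1 + d 2 + d 3 + d 4 + d 5 = 0 := by
      refine eq_zero_of_mul_eq_zero_of_pos ?_ A6
      linarith only [mul_pos hy hy]
    rcases s01.eq_or_lt with hxy | hxy
    · subst hxy
      have b1 : l 8 - l 6 = 0 := eq_zero_of_mul_eq_zero_of_pos hy (by linarith only [gl1, gl2])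
      have b2 : l 8 + d 8 - (l 6 + d 6) = 0 :=
        eq_zero_of_mul_eq_zero_of_pos hy (by linarith only [gn1, gn2])
      clear A1 A2 A3 A4 A5 A6 A7 A8 gl1 gl2 gl3 gn1 gn2 gn3 hgl hgn
      apply eq_zero_of_fin_nine <;> linarith
    · have a7 : d 0 + d 1 + d 2 + d 3 + d 4 + d 5 + d 6 = 0 := by
        refine eq_zero_of_mul_eq_zero_of_pos ?_ A7
        linarith only [mul_pos hy (sub_pos.2 hxy)]
      have a8 : d 0 + d 1 + d 2 + d 3 + d 4 + d 5 + d 6 + d 7 = 0 := by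
        refine eq_zero_of_mul_eq_zero_of_pos ?_ A8
        linarith only [mul_pos hx (sub_pos.2 hxy)]
      clear A1 A2 A3 A4 A5 A6 A7 A8 gl1 gl2 gl3 gn1 gn2 gn3 hgl hgn
      apply eq_zero_of_fin_nine <;> linarith
  have a3 : d 0 + d 1 + d 2 = 0 := by
    refine eq_zero_of_mul_eq_zero_of_pos ?_ A3
    linarith only [mul_pos hz hz, mul_pos hy hz]
  have c1 : 2 * d 8 * x + (d 7 - d 0) * y + (d 5 - d 1) * z = 0 := by linarith only [gl1, gn1]
  have c2 : (d 7 - d 0) * x + 2 * d 6 * y + (d 4 - d 2) * z = 0 := by linarith only [gl2, gn2]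
  have c3 : (d 5 - d 1) * x + (d 4 - d 2) * y + 2 * d 3 * z = 0 := by linarith only [gl3, gn3]
  clear l01 l12 l23 l34 l45 l56 l67 l78 n01 n12 n23 n34 n45 n56 n67 n78
  rcases s12.eq_or_lt with hyz | hyz
  · subst hyz
    obtain rfl : x = z := le_antisymm (le_of_mul_le_mul_right hle hz) s01
    -- All positive weights coincide, so Abel summation yields little. Comparing the gradients of
    -- the two forms supplies the missing relation `d 5 = d 6`.
    have c4 := (hgl rfl).1
    have c5 := (hgn rfl).1
    have f1 : 2 * d 8 + (d 7 - d 0) + (d 5 - d 1) = 0 :=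
      eq_zero_of_mul_eq_zero_of_pos hx (by linarith only [c1])
    have f2 : (d 5 - d 1) + (d 4 - d 2) + 2 * d 3 = 0 :=
      eq_zero_of_mul_eq_zero_of_pos hx (by linarith only [c3])
    have f3 : 2 * d 8 + (d 7 - d 0) + (d 6 - d 1) = 0 :=
      eq_zero_of_mul_eq_zero_of_pos hx (by linarith only [c4, c5])
    clear A1 A2 A3 A4 A5 A6 A7 A8 gl1 gl2 gl3 gn1 gn2 gn3 hgl hgn c1 c2 c3 c4 c5
    apply eq_zero_of_fin_nine <;> linarith
  have a1 : d 0 = 0 := by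
    refine eq_zero_of_mul_eq_zero_of_pos ?_ A1
    linarith only [mul_pos hx (sub_pos.2 hyz)]
  have a4 : d 0 + d 1 + d 2 + d 3 = 0 := by
    refine eq_zero_of_mul_eq_zero_of_pos ?_ A4
    linarith only [mul_pos hz (sub_pos.2 hyz)]
  clear gl1 gl2 gl3 gn1 gn2 gn3 hgl hgn
  rcases s01.eq_or_lt with hxy | hxy
  · subst hxy
    have a6 : d 0 + d 1 + d 2 + d 3 + d 4 + d 5 = 0 := by
      refine eq_zero_of_mul_eq_zero_of_pos ?_ A6
      linarith only [mul_pos hy (sub_pos.2 hyz)]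
    -- Since `d 6 + d 7 + d 8 = 0`, the coefficient becomes `d 8 - d 6`, whose sign the partial sums
    -- determine.
    have e : 2 * d 8 + (d 7 - d 0) = d 8 - d 6 := by linarith only [a1, a6, D9]
    obtain ⟨f1, f2⟩ := eq_zero_of_nonpos_combination (a := 2 * d 8 + (d 7 - d 0)) (b := d 5 - d 1)
      (by linarith only [e, D7, D8, D9, a6]) (by linarith only [a6, D5, a1, D2]) hy hz
      (by linarith only [c1])
    clear A1 A2 A3 A4 A5 A6 A7 A8 c1 c2 c3
    apply eq_zero_of_fin_nine <;> linarith
  · have a2 : d 0 + d 1 = 0 := by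
      refine eq_zero_of_mul_eq_zero_of_pos ?_ A2
      linarith only [mul_pos hz (sub_pos.2 hxy)]
    have a5 : d 0 + d 1 + d 2 + d 3 + d 4 = 0 := by
      refine eq_zero_of_mul_eq_zero_of_pos ?_ A5
      linarith only [mul_pos hz (sub_pos.2 hxy)]
    have a7 : d 0 + d 1 + d 2 + d 3 + d 4 + d 5 + d 6 = 0 := by
      refine eq_zero_of_mul_eq_zero_of_pos ?_ A7
      linarith only [mul_pos hy (sub_pos.2 hxy)]
    have a8 : d 0 + d 1 + d 2 + d 3 + d 4 + d 5 + d 6 + d 7 = 0 := by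
      refine eq_zero_of_mul_eq_zero_of_pos ?_ A8
      linarith only [mul_pos hx (sub_pos.2 hxy)]
    have z1 : d 1 = 0 := by linarith only [a1, a2]
    have z7 : d 7 = 0 := by linarith only [a7, a8]
    have z8 : d 8 = 0 := by linarith only [a8, D9]
    -- Only the weights `y * y` and `x * z` can still tie, leaving `d 5 + d 6 = 0`; the first
    -- gradient component removes `d 5`.
    rw [a1, z1, z7, z8] at c1
    have z5 : d 5 = 0 := eq_zero_of_mul_eq_zero_of_pos hz (by linarith only [c1])
    clear A1 A2 A3 A4 A5 A6 A7 A8 c1 c2 c3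
    apply eq_zero_of_fin_nine <;> linarith

/-- The analogue of `Majorizes.eq_of_sortedWeight₁` for the second form. -/
theorem Majorizes.eq_of_sortedWeight₂ {n l : Fin 9 → ℝ} (hnl : Majorizes n l) (hl : Antitone l)
    (hn : Antitone n) (hl₁ : ∀ s, 0 ≤ ∑ k, l k * sortedWeight₁ s k)
    (hl₂ : ∀ s, 0 ≤ ∑ k, l k * sortedWeight₂ s k) (hn₁ : ∀ s, 0 ≤ ∑ k, n k * sortedWeight₁ s k)
    (hn₂ : ∀ s, 0 ≤ ∑ k, n k * sortedWeight₂ s k) {s : Fin 3 → ℝ} (hs : s ∈ schmidtSimplex)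
    (hle : s 1 * s 1 ≤ s 0 * s 2) (h0 : ∑ k, l k * sortedWeight₂ s k = 0) : n = l := by
  -- On the common boundary of the two regions the forms agree, so the first case applies.
  rcases hle.eq_or_lt with heq | hlt
  · refine hnl.eq_of_sortedWeight₁ hl hn hl₁ hl₂ hn₁ hn₂ hs heq.ge ?_
    rw [sum_mul_sortedWeight₂] at h0
    rw [sum_mul_sortedWeight₁]
    linear_combination h0 + (l 6 - l 5) * heq
  have hmono := monotone_sortedWeight₂ hs.1 hs.2.1 hle
  have hn0 : ∑ k, n k * sortedWeight₂ s k = 0 :=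
    le_antisymm ((hnl _ hmono).trans_eq h0) (hn₂ s)
  obtain ⟨d, hd, D1, D2, D3, D4, D5, D6, D7, D8, D9⟩ := hnl.partial_sums
  have hd0 : 0 ≤ ∑ k, d k * sortedWeight₂ s k := by
    have : ∑ k, n k * sortedWeight₂ s k = ∑ k, l k * sortedWeight₂ s k +
        ∑ k, d k * sortedWeight₂ s k := by
      rw [hd, ← Finset.sum_add_distrib]
      exact Finset.sum_congr rfl fun k _ => add_mul _ _ _
    linarith
  obtain ⟨A1, A2, A3, A4, A5, A6, A7, A8⟩ := abel_terms_eq_zero hmono D1 D2 D3 D4 D5 D6 D7 D8 D9 hd0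
  obtain ⟨gl1, gl2, gl3⟩ := gradient_sortedWeight₂ hl₂ h0
  obtain ⟨gn1, gn2, gn3⟩ := gradient_sortedWeight₂ hn₂ hn0
  have hnk : ∀ k, n k = l k + d k := fun k => by rw [hd]; rfl
  suffices d = 0 by rw [hd, this, add_zero]
  have s01 := hs.1 (show (0 : Fin 3) ≤ 1 by decide)
  have s12 := hs.1 (show (1 : Fin 3) ≤ 2 by decide)
  have s2 := hs.2.1 2
  clear hn0 hd0 hl₁ hl₂ hn₁ hn₂ h0 hmono hnl hs hl hn hd
  simp only [sortedWeight₂, Matrix.cons_val] at A1 A2 A3 A4 A5 A6 A7 A8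
  simp only [hnk] at gn1 gn2 gn3
  clear hnk
  generalize s 0 = x at *
  generalize s 1 = y at *
  generalize s 2 = z at *
  have hz : 0 < z := by
    refine lt_of_le_of_ne s2 fun hz => ?_
    rw [← hz, mul_zero] at hlt
    exact absurd hlt (not_lt.2 (mul_self_nonneg y))
  have hy : 0 < y := hz.trans_le s12
  have hxy : y < x := lt_of_mul_lt_mul_right (hlt.trans_le'
    (mul_le_mul_of_nonneg_left s12 hy.le)) hz.le
  have hx : 0 < x := hy.trans hxy
  have c2 : (d 7 - d 0) * x + 2 * d 5 * y + (d 4 - d 2) * z = 0 := by linarith only [gl2, gn2]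
  have a2 : d 0 + d 1 = 0 := by
    refine eq_zero_of_mul_eq_zero_of_pos ?_ A2
    linarith only [mul_pos hz (sub_pos.2 hxy)]
  have a3 : d 0 + d 1 + d 2 = 0 := by
    refine eq_zero_of_mul_eq_zero_of_pos ?_ A3
    linarith only [mul_pos hz hz, mul_pos hy hz]
  have a6 : d 0 + d 1 + d 2 + d 3 + d 4 + d 5 = 0 := by
    refine eq_zero_of_mul_eq_zero_of_pos ?_ A6
    linarith only [hlt]
  have a8 : d 0 + d 1 + d 2 + d 3 + d 4 + d 5 + d 6 + d 7 = 0 := by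
    refine eq_zero_of_mul_eq_zero_of_pos ?_ A8
    linarith only [mul_pos hx (sub_pos.2 hxy)]
  clear gl1 gl2 gl3 gn1 gn2 gn3
  rcases s12.eq_or_lt with hyz | hyz
  · subst hyz
    -- Here `d 2 = 0` and `d 3 + d 4 + d 5 = 0`, so the coefficient has the sign of `d 5 - d 3`.
    have e : 2 * d 5 + (d 4 - d 2) = d 5 - d 3 := by linarith only [a3, a6, a2]
    obtain ⟨f1, f2⟩ := eq_zero_of_nonpos_combination (a := d 7 - d 0)
      (b := 2 * d 5 + (d 4 - d 2)) (by linarith only [a8, D7, D1])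
      (by linarith only [e, D4, D5, a6, a3]) hx hz (by linarith only [c2])
    clear A1 A2 A3 A4 A5 A6 A7 A8 c2
    apply eq_zero_of_fin_nine <;> linarith
  -- All nine weights are distinct, so Abel summation alone suffices.
  · have a1 : d 0 = 0 := by
      refine eq_zero_of_mul_eq_zero_of_pos ?_ A1
      linarith only [mul_pos hx (sub_pos.2 hyz)]
    have a4 : d 0 + d 1 + d 2 + d 3 = 0 := by
      refine eq_zero_of_mul_eq_zero_of_pos ?_ A4
      linarith only [mul_pos hz (sub_pos.2 hyz)]
    have a5 : d 0 + d 1 + d 2 + d 3 + d 4 = 0 := by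
      refine eq_zero_of_mul_eq_zero_of_pos ?_ A5
      linarith only [mul_pos hy (sub_pos.2 hyz)]
    have a7 : d 0 + d 1 + d 2 + d 3 + d 4 + d 5 + d 6 = 0 := by
      refine eq_zero_of_mul_eq_zero_of_pos ?_ A7
      linarith only [mul_pos hx (sub_pos.2 hyz)]
    clear A1 A2 A3 A4 A5 A6 A7 A8 c2
    apply eq_zero_of_fin_nine <;> linarith

/-! ### Unitary orbits, Schur's theorem and segments -/

/-- The conjugating unitary is absorbed into the universally quantified one; this is what reduces
membership to the spectrum. -/
theorem conj_mem_absPPT {m n : ℕ} {ρ V : Matrix (Fin m × Fin n) (Fin m × Fin n) ℂ}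
    (hρ : ρ ∈ AbsPPT m n) (hV : V ∈ Matrix.unitaryGroup (Fin m × Fin n) ℂ) :
    V * ρ * V.conjTranspose ∈ AbsPPT m n := by
  refine ⟨⟨hρ.1.1.mul_mul_conjTranspose_same V, ?_⟩, fun U hU => ?_⟩
  · rw [Matrix.trace_mul_cycle, ← Matrix.star_eq_conjTranspose, Matrix.mem_unitaryGroup_iff'.1 hV,
      Matrix.one_mul, hρ.1.2]
  · have h := hρ.2 (U * V) (mul_mem hU hV)
    rw [Matrix.conjTranspose_mul] at h
    simpa only [Matrix.mul_assoc] using h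

theorem diagMat_injective {m n : ℕ} : Function.Injective (diagMat (m := m) (n := n)) := by
  intro a b h
  ext k
  have hk := congrFun (Matrix.diagonal_injective h) (finProdFinEquiv.symm k)
  simpa only [Equiv.apply_symm_apply, Complex.ofReal_inj] using hk

/-- With both diagonals in the same order, the pairings in Hildebrand's criterion are linear in the
diagonal. -/
theorem diagMat_convexCombination_mem_absPPT {a b : Fin (3 * 3) → ℝ} (ha : Antitone a)
    (hb : Antitone b) (ha' : (diagMat a : Matrix (Fin 3 × Fin 3) (Fin 3 × Fin 3) ℂ) ∈ AbsPPT 3 3)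
    (hb' : (diagMat b : Matrix (Fin 3 × Fin 3) (Fin 3 × Fin 3) ℂ) ∈ AbsPPT 3 3) {t u : ℝ}
    (ht : 0 ≤ t) (hu : 0 ≤ u) (htu : t + u = 1) :
    Antitone (fun k => t * a k + u * b k) ∧
      (diagMat (fun k => t * a k + u * b k) : Matrix (Fin 3 × Fin 3) (Fin 3 × Fin 3) ℂ) ∈
        AbsPPT 3 3 := by
  have hanti : Antitone (fun k => t * a k + u * b k) := fun i j hij =>
    add_le_add (mul_le_mul_of_nonneg_left (ha hij) ht) (mul_le_mul_of_nonneg_left (hb hij) hu)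
  have hlin : ∀ v : Fin (3 * 3) → ℝ,
      ∑ k, (t * a k + u * b k) * v k = t * ∑ k, a k * v k + u * ∑ k, b k * v k := by
    intro v
    rw [Finset.mul_sum, Finset.mul_sum, ← Finset.sum_add_distrib]
    exact Finset.sum_congr rfl fun k _ => by ring
  refine ⟨hanti, diagMat_mem_absPPT hanti ?_ (fun s _ _ _ => ?_) fun s _ _ _ => ?_⟩
  · rw [Finset.sum_add_distrib, ← Finset.mul_sum, ← Finset.mul_sum,
      sum_eq_one_of_diagMat_mem_absPPT ha', sum_eq_one_of_diagMat_mem_absPPT hb', mul_one, mul_one,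
      htu]
  · exact (add_nonneg (mul_nonneg ht (sum_mul_sortedWeight_nonneg ha' s).1)
      (mul_nonneg hu (sum_mul_sortedWeight_nonneg hb' s).1)).trans_eq (hlin _).symm
  · exact (add_nonneg (mul_nonneg ht (sum_mul_sortedWeight_nonneg ha' s).2)
      (mul_nonneg hu (sum_mul_sortedWeight_nonneg hb' s).2)).trans_eq (hlin _).symm

/-- **Schur's theorem**: the eigenvalues majorize the diagonal. -/
theorem sum_eigenvalues_mul_le_sum_diag_mul {m n : ℕ}
    {U : Matrix (Fin m × Fin n) (Fin m × Fin n) ℂ}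
    (hU : U ∈ Matrix.unitaryGroup (Fin m × Fin n) ℂ) {a w : Fin (m * n) → ℝ} (ha : Antitone a)
    (hw : Monotone w) :
    ∑ k, a k * w k ≤
      ∑ p, ((U * diagMat a * U.conjTranspose) p p).re * w (finProdFinEquiv p) := by
  have h := (antivary_comp_of_monotone_of_antitone hw ha
    (finProdFinEquiv (m := m) (n := n))).sum_mul_le_sum_doublyStochastic
      (normSq_mem_doublyStochastic hU)
  rw [← Equiv.sum_comp finProdFinEquiv]
  refine (le_of_eq (Finset.sum_congr rfl fun p _ => mul_comm _ _)).trans (h.trans_eq ?_)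
  refine Finset.sum_congr rfl fun p _ => ?_
  rw [Matrix.mul_apply, Complex.re_sum, Finset.sum_mul]
  refine Finset.sum_congr rfl fun q _ => ?_
  have : (U * diagMat a) p q * U.conjTranspose q p =
      ((Complex.normSq (U p q) * a (finProdFinEquiv q) : ℝ) : ℂ) := by
    rw [diagMat, Matrix.mul_diagonal, Matrix.conjTranspose_apply, Complex.ofReal_mul,
      ← Complex.mul_conj, RCLike.star_def]
    ring
  rw [this, Complex.ofReal_re, Matrix.of_apply]
  ring

theorem AbsPPT.exists_eq_conj_diagMat {m n : ℕ} {ρ : Matrix (Fin m × Fin n) (Fin m × Fin n) ℂ}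
    (hρ : ρ ∈ AbsPPT m n) :
    ∃ U ∈ Matrix.unitaryGroup (Fin m × Fin n) ℂ, ∃ a : Fin (m * n) → ℝ, Antitone a ∧
      diagMat a ∈ AbsPPT m n ∧ ρ = U * diagMat a * U.conjTranspose := by
  obtain ⟨U, hU, a, ha, h⟩ := hρ.1.1.isHermitian.exists_eq_antitone_diagonal finProdFinEquiv
  refine ⟨U, hU, a, ha, ?_, h⟩
  have hUU : U.conjTranspose * U = 1 := Matrix.mem_unitaryGroup_iff'.1 hU
  have hc := conj_mem_absPPT hρ (conjTranspose_mem_unitaryGroup hU)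
  rw [h, Matrix.conjTranspose_conjTranspose, Matrix.mul_assoc, Matrix.mul_assoc, hUU,
    Matrix.mul_one, ← Matrix.mul_assoc, hUU, Matrix.one_mul] at hc
  exact hc

theorem trace_conj_mul_self {n : Type*} [Fintype n] [DecidableEq n] {U : Matrix n n ℂ}
    (hU : U ∈ Matrix.unitaryGroup n ℂ) (A : Matrix n n ℂ) :
    ((U * A * U.conjTranspose) * (U * A * U.conjTranspose)).trace = (A * A).trace := by
  have hUU : U.conjTranspose * U = 1 := Matrix.mem_unitaryGroup_iff'.1 hU
  have h : (U * A * U.conjTranspose) * (U * A * U.conjTranspose) =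
      U * (A * A) * U.conjTranspose := by
    calc _ = U * A * (U.conjTranspose * U) * A * U.conjTranspose := by
          simp only [Matrix.mul_assoc]
      _ = _ := by rw [hUU, Matrix.mul_one]; simp only [Matrix.mul_assoc]
  rw [h, Matrix.trace_mul_cycle, hUU, Matrix.one_mul]

/-- Strict convexity of the Frobenius norm on Hermitian matrices. -/
theorem eq_of_trace_mul_self_eq {n : Type*} [Fintype n] {A B : Matrix n n ℂ}
    (hA : A.IsHermitian) (hB : B.IsHermitian) {t u : ℝ} (ht : 0 < t) (hu : 0 < u)
    (htu : t + u = 1) (hAB : (A * A).trace = (B * B).trace)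
    (hC : ((t • A + u • B) * (t • A + u • B)).trace = (A * A).trace) : A = B := by
  -- The defect in the convexity of the squared norm is `t * u` times the squared distance.
  have hid : (t * u) • ((A - B) * (A - B)) =
      t • (A * A) + u • (B * B) - (t • A + u • B) * (t • A + u • B) := by
    obtain rfl : u = 1 - t := by linarith
    simp only [mul_add, add_mul, mul_sub, sub_mul, smul_mul_assoc, mul_smul_comm]
    module
  have htr : ((A - B) * (A - B).conjTranspose).trace = 0 := by
    rw [(hA.sub hB).eq]
    have h := congrArg Matrix.trace hid
    rw [Matrix.trace_sub, Matrix.trace_add, Matrix.trace_smul, Matrix.trace_smul,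
      Matrix.trace_smul, hC, ← hAB, ← add_smul, htu, one_smul, sub_self] at h
    exact (smul_eq_zero.1 h).resolve_left (mul_pos ht hu).ne'
  exact sub_eq_zero.1 (Matrix.trace_mul_conjTranspose_self_eq_zero_iff.1 htr)

/-- The spectra of the endpoints of a segment through a diagonal boundary point average to its
diagonal. -/
theorem IsAbsPPTBoundary.eq_convexCombination_spectra {l : Fin (3 * 3) → ℝ} (hl : Antitone l)
    (hρ : IsAbsPPTBoundary (diagMat l : Matrix (Fin 3 × Fin 3) (Fin 3 × Fin 3) ℂ))
    {U V : Matrix (Fin 3 × Fin 3) (Fin 3 × Fin 3) ℂ}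
    (hU : U ∈ Matrix.unitaryGroup (Fin 3 × Fin 3) ℂ)
    (hV : V ∈ Matrix.unitaryGroup (Fin 3 × Fin 3) ℂ) {a b : Fin (3 * 3) → ℝ} (ha : Antitone a)
    (hb : Antitone b) (ha' : (diagMat a : Matrix (Fin 3 × Fin 3) (Fin 3 × Fin 3) ℂ) ∈ AbsPPT 3 3)
    (hb' : (diagMat b : Matrix (Fin 3 × Fin 3) (Fin 3 × Fin 3) ℂ) ∈ AbsPPT 3 3) {t u : ℝ}
    (ht : 0 ≤ t) (hu : 0 ≤ u) (htu : t + u = 1)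
    (h : t • (U * diagMat a * U.conjTranspose) + u • (V * diagMat b * V.conjTranspose) =
      diagMat l) : (fun k => t * a k + u * b k) = l := by
  obtain ⟨hν, hν'⟩ := diagMat_convexCombination_mem_absPPT ha hb ha' hb' ht hu htu
  -- Schur's theorem at each endpoint; the diagonals of the endpoints average to `l`.
  have hmaj : Majorizes (fun k => t * a k + u * b k) l := by
    intro w hw
    have h1 := mul_le_mul_of_nonneg_left (sum_eigenvalues_mul_le_sum_diag_mul hU ha hw) ht
    have h2 := mul_le_mul_of_nonneg_left (sum_eigenvalues_mul_le_sum_diag_mul hV hb hw) hu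
    rw [Finset.mul_sum, Finset.mul_sum] at h1 h2
    calc ∑ k, (t * a k + u * b k) * w k = ∑ k, t * (a k * w k) + ∑ k, u * (b k * w k) := by
          rw [← Finset.sum_add_distrib]
          exact Finset.sum_congr rfl fun k _ => by ring
      _ ≤ _ := add_le_add h1 h2
      _ = ∑ p, l (finProdFinEquiv p) * w (finProdFinEquiv p) := by
          rw [← Finset.sum_add_distrib]
          refine Finset.sum_congr rfl fun p _ => ?_
          have hp := congrArg Complex.re (congrFun (congrFun h p) p)
          have hd : ((diagMat l : Matrix (Fin 3 × Fin 3) (Fin 3 × Fin 3) ℂ) p p).re =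
              l (finProdFinEquiv p) := by
            rw [diagMat, Matrix.diagonal_apply_eq, Complex.ofReal_re]
          rw [hd, Matrix.add_apply, Matrix.smul_apply, Matrix.smul_apply, Complex.add_re,
            Complex.smul_re, Complex.smul_re, smul_eq_mul, smul_eq_mul] at hp
          rw [← hp]
          ring
      _ = ∑ k, l k * w k := Equiv.sum_comp finProdFinEquiv fun k => l k * w k
  have hl' := sum_mul_sortedWeight_nonneg hρ.1
  have hn' := sum_mul_sortedWeight_nonneg hν'
  obtain ⟨s, hs, ⟨hle, h0⟩ | ⟨hle, h0⟩⟩ := hρ.exists_sum_mul_sortedWeight_eq_zero hl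
  · exact hmaj.eq_of_sortedWeight₁ hl hν (fun s => (hl' s).1) (fun s => (hl' s).2)
      (fun s => (hn' s).1) (fun s => (hn' s).2) hs hle h0
  · exact hmaj.eq_of_sortedWeight₂ hl hν (fun s => (hl' s).1) (fun s => (hl' s).2)
      (fun s => (hn' s).1) (fun s => (hn' s).2) hs hle h0

/-! ### Extreme points and midpoints -/

/-- Unit traces make the coefficients of a vanishing combination opposite, so distinct states are
independent. -/
theorem linearIndependent_diagMat_pair {m n : ℕ} {a b : Fin (m * n) → ℝ}
    (ha : diagMat a ∈ AbsPPT m n) (hb : diagMat b ∈ AbsPPT m n) (hab : a ≠ b) :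
    LinearIndependent ℂ ![(diagMat a : Matrix (Fin m × Fin n) (Fin m × Fin n) ℂ), diagMat b] := by
  rw [LinearIndependent.pair_iff]
  intro x y h
  have htr := congrArg Matrix.trace h
  rw [Matrix.trace_add, Matrix.trace_smul, Matrix.trace_smul, ha.1.2, hb.1.2, Matrix.trace_zero,
    smul_eq_mul, smul_eq_mul, mul_one, mul_one] at htr
  obtain rfl : y = -x := by linear_combination htr
  rw [neg_smul, ← sub_eq_add_neg, ← smul_sub, smul_eq_zero] at h
  have hx : x = 0 := h.resolve_right fun h' => hab (diagMat_injective (sub_eq_zero.1 h'))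
  simp [hx]

theorem theorem4p3 (l : Fin (3 * 3) → ℝ) (hl : Antitone l)
    (hρ : IsAbsPPTBoundary (diagMat l : Matrix (Fin 3 × Fin 3) (Fin 3 × Fin 3) ℂ)) :
    (diagMat l : Matrix (Fin 3 × Fin 3) (Fin 3 × Fin 3) ℂ) ∉ (AbsPPT 3 3).extremePoints ℝ ↔
      ∃ a b : Fin (3 * 3) → ℝ, Antitone a ∧ Antitone b ∧
        diagMat a ∈ AbsPPT 3 3 ∧ diagMat b ∈ AbsPPT 3 3 ∧
        LinearIndependent ℂ
          ![(diagMat a : Matrix (Fin 3 × Fin 3) (Fin 3 × Fin 3) ℂ), diagMat b] ∧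
        (diagMat l : Matrix (Fin 3 × Fin 3) (Fin 3 × Fin 3) ℂ) =
          (1 / 2 : ℝ) • (diagMat a + diagMat b) := by
  constructor
  · intro h
    rw [mem_extremePoints] at h
    push Not at h
    obtain ⟨ρ₁, h₁, ρ₂, h₂, ⟨t, u, ht, hu, htu, hseg⟩, hne⟩ := h hρ.1
    have hne' : ρ₁ ≠ ρ₂ := by
      rintro rfl
      rw [← add_smul, htu, one_smul] at hseg
      exact hne hseg hseg
    obtain ⟨U, hU, a, ha, ha', e₁⟩ := AbsPPT.exists_eq_conj_diagMat h₁
    obtain ⟨V, hV, b, hb, hb', e₂⟩ := AbsPPT.exists_eq_conj_diagMat h₂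
    have hmean := hρ.eq_convexCombination_spectra hl hU hV ha hb ha' hb' ht.le hu.le htu
      (by rw [← e₁, ← e₂, hseg])
    -- Equal spectra would both equal `l`, giving the endpoints and their combination the same
    -- Frobenius norm.
    have hab : a ≠ b := by
      rintro rfl
      have hal : a = l := by
        rw [← hmean]
        ext k
        rw [← add_mul, htu, one_mul]
      refine hne' (eq_of_trace_mul_self_eq h₁.1.1.isHermitian h₂.1.1.isHermitian ht hu htu ?_ ?_)
      · rw [e₁, e₂, trace_conj_mul_self hU, trace_conj_mul_self hV]
      · rw [hseg, e₁, trace_conj_mul_self hU, hal]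
    -- Shifting the weights by `±η` keeps them nonnegative and makes `l` the midpoint, whatever `t`
    -- was.
    set η := min t u with hη
    have hη0 : 0 < η := lt_min ht hu
    have hηt : η ≤ t := min_le_left _ _
    have hηu : η ≤ u := min_le_right _ _
    obtain ⟨hα, hα'⟩ := diagMat_convexCombination_mem_absPPT ha hb ha' hb'
      (t := t + η) (u := u - η) (by linarith) (by linarith) (by linarith)
    obtain ⟨hβ, hβ'⟩ := diagMat_convexCombination_mem_absPPT ha hb ha' hb'
      (t := t - η) (u := u + η) (by linarith) (by linarith) (by linarith)
    refine ⟨_, _, hα, hβ, hα', hβ', linearIndependent_diagMat_pair hα' hβ' ?_, ?_⟩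
    · intro heq
      apply hab
      ext k
      have hk : (t + η) * a k + (u - η) * b k = (t - η) * a k + (u + η) * b k := congrFun heq k
      have : η * (a k - b k) = 0 := by linarith
      exact sub_eq_zero.1 ((mul_eq_zero.1 this).resolve_left hη0.ne')
    · rw [← hmean]
      ext p q
      by_cases hpq : p = q
      · subst hpq
        simp [diagMat]
        ring
      · simp [diagMat, hpq]
  · rintro ⟨a, b, -, -, ha', hb', hli, heq⟩ hext
    have hab : (diagMat a : Matrix (Fin 3 × Fin 3) (Fin 3 × Fin 3) ℂ) ≠ diagMat b := by
      intro h
      have := hli.injective.ne (show (0 : Fin 2) ≠ 1 by decide)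
      exact this h
    have h := (mem_extremePoints.1 hext).2 _ ha' _ hb'
      ⟨1 / 2, 1 / 2, by norm_num, by norm_num, by norm_num, by rw [heq, smul_add]⟩
    exact hab (h.1.trans h.2.symm)
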